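/- For integers $k\ge 0$ and $n\ge 1$, the $k$-path power on $n$ vertices is the graph with vertices $v_1,\dots,v_n$ in which, for $1\le i<j\le n$, the vertices $v_i$ and $v_j$ are adjacent if and only if $j-i\le k$. Let $Z_k$ be the $k$-path power on $k(k+1)+2$ vertices. A $k$-expression builds a vertex-labelled graph with labels from $\{1,\dots,k\}$ by the following operations: creating a single labelled vertex; disjoint union of two labelled graphs; joining all vertices with label $i$ to all vertices with label $j$, where $i\ne j$; changing every label $i$ into $j$. It is linear if in every union at least one operand creates a single labelled vertex. The clique-width $\mathrm{cwd}(G)$ (linear clique-width $\mathrm{lcwd}(G)$) of a graph $G$ is the smallest $k$ such that $G$ is defined by a $k$-expression (by a linear $k$-expression); both are $0$ for the graph without vertices. Then for every $k\ge 0$, every proper induced subgraph of $Z_k$ has linear clique-width at most $k+1$. Moreover, for every $k\ge 1$, $\mathrm{cwd}(Z_k)\ge k+2$, and $Z_k$ is a minimal forbidden induced subgraph for the class of graphs of clique-width at most $k+1$ as well as for the class of graphs of linear clique-width at most $k+1$; that is, $Z_k$ is not in the class, but every proper induced subgraph of $Z_k$ is. -/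

import Mathlib

/-- The `k`-path power on `n` vertices, with `k`-path layout `0, 1, …, n - 1`: for `i < j`, the
vertices `i` and `j` are adjacent if and only if `j - i ≤ k`. -/
def pathPower (k n : ℕ) : SimpleGraph (Fin n) :=
  SimpleGraph.fromRel fun i j => i < j ∧ (j : ℕ) ≤ (i : ℕ) + k

/-- The graph `Z_k`: the `k`-path power on `k (k + 1) + 2` vertices. -/
def graphZ (k : ℕ) : SimpleGraph (Fin (k * (k + 1) + 2)) :=
  pathPower k (k * (k + 1) + 2)

/-- Syntax of clique-width expressions with labels from `Fin k`; the vertices that an expression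
creates are named by elements of `V`. -/
inductive CliqueExpr (V : Type*) (k : ℕ) where
  /-- create the vertex `v` with label `i` -/
  | vertex (i : Fin k) (v : V) : CliqueExpr V k
  /-- disjoint union of two labelled graphs -/
  | union (e f : CliqueExpr V k) : CliqueExpr V k
  /-- add all edges between vertices with label `i` and vertices with label `j` -/
  | join (i j : Fin k) (e : CliqueExpr V k) : CliqueExpr V k
  /-- change every label `i` into label `j` -/
  | relabel (i j : Fin k) (e : CliqueExpr V k) : CliqueExpr V k

namespace CliqueExpr

variable {V : Type*} {k : ℕ}

/-- The vertex set of the labelled graph defined by an expression. -/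
def verts : CliqueExpr V k → Set V
  | vertex _ v => {v}
  | union e f => e.verts ∪ f.verts
  | join _ _ e => e.verts
  | relabel _ _ e => e.verts

/-- `e.HasLabel u a`: the vertex `u` of the labelled graph defined by `e` has label `a`. -/
def HasLabel : CliqueExpr V k → V → Fin k → Prop
  | vertex i v, u, a => u = v ∧ a = i
  | union e f, u, a => e.HasLabel u a ∨ f.HasLabel u a
  | join _ _ e, u, a => e.HasLabel u a
  | relabel i j e, u, a => (e.HasLabel u a ∧ a ≠ i) ∨ (e.HasLabel u i ∧ a = j)

/-- The edges of the labelled graph defined by an expression, as a graph on all of `V`. -/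
def graph : CliqueExpr V k → SimpleGraph V
  | vertex _ _ => ⊥
  | union e f => e.graph ⊔ f.graph
  | join i j e => e.graph ⊔ SimpleGraph.fromRel fun u w => e.HasLabel u i ∧ e.HasLabel w j
  | relabel _ _ e => e.graph

/-- An expression is well formed if all its unions are disjoint (so that no vertex is created
twice) and all its joins are between two distinct labels. -/
def WellFormed : CliqueExpr V k → Prop
  | vertex _ _ => True
  | union e f => e.WellFormed ∧ f.WellFormed ∧ Disjoint e.verts f.verts
  | join i j e => i ≠ j ∧ e.WellFormed
  | relabel _ _ e => e.WellFormed

/-- The expression creates a single labelled vertex. -/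
def IsVertex (e : CliqueExpr V k) : Prop :=
  ∃ (i : Fin k) (v : V), e = vertex i v

/-- An expression is linear if in each of its unions at least one of the two operands creates a
single labelled vertex. -/
def IsLinear : CliqueExpr V k → Prop
  | vertex _ _ => True
  | union e f => e.IsLinear ∧ f.IsLinear ∧ (e.IsVertex ∨ f.IsVertex)
  | join _ _ e => e.IsLinear
  | relabel _ _ e => e.IsLinear

/-- The well-formed expression `e` defines (up to the labels) the graph `G`. -/
def Defines (e : CliqueExpr V k) (G : SimpleGraph V) : Prop :=
  e.WellFormed ∧ e.verts = Set.univ ∧ e.graph = G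

end CliqueExpr

/-- The clique-width of `G`: the smallest `k` such that some `k`-expression defines `G`. The graph
without vertices has clique-width `0`; a graph without any expression has clique-width `⊤`. -/
noncomputable def cliqueWidth {V : Type*} (G : SimpleGraph V) : ℕ∞ :=
  sInf {m : ℕ∞ | ∃ k : ℕ, m = k ∧ (IsEmpty V ∨ ∃ e : CliqueExpr V k, e.Defines G)}

/-- The linear clique-width of `G`: the smallest `k` such that some linear `k`-expression defines
`G`. The graph without vertices has linear clique-width `0`. -/
noncomputable def linearCliqueWidth {V : Type*} (G : SimpleGraph V) : ℕ∞ :=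
  sInf {m : ℕ∞ | ∃ k : ℕ, m = k ∧
    (IsEmpty V ∨ ∃ e : CliqueExpr V k, e.IsLinear ∧ e.Defines G)}

/-- `G` is a minimal forbidden induced subgraph for the class of the graphs with property `P`:
it is not in the class, but all its proper induced subgraphs are. -/
def IsMinimalForbiddenInducedSubgraph (P : ∀ {W : Type}, SimpleGraph W → Prop)
    {V : Type} (G : SimpleGraph V) : Prop :=
  ¬ P G ∧ ∀ S : Set V, S ≠ Set.univ → P (G.induce S)

/-! Upper bound. It suffices to build `Z_k` minus one vertex `x` by a linear expression with `k + 1`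
labels. Vertices are created along a layout, and created vertices share a label only if they have
the same neighbours among those still to come (`Uniform`). A vertex can be added if the created ones
fall into at most `k` classes, so that a label is free, or if it may reuse a label (`CanAdd`). Cut
the path into columns of `k + 1` consecutive vertices. If `x` is an end, what remains is one vertex
and `k` full columns; they are created row by row, each column is one class, and the extra vertex
shares the label of the first column. Otherwise columns are counted from `x` outwards on both sides
and created along diagonals: the right side inwards, then the left side outwards.

Lower bound for `k ≥ 2`. Let the positions be `1, …, n` with `n = k (k + 1) + 2`. With at most `k +
1` labels, every subexpression that creates `k + 1` consecutive vertices (a window) misses `k`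
consecutive inner ones (a gap); the whole graph violates this. Only unions matter in the induction
(`IsUnion.hasGap`). If one operand has a window, hence a gap, it uses all labels, which confines the
other operand to the two ends, and the gap survives. If neither has a window, the operands use
disjoint sets of labels; colour vertices by operand, so that equal labels mean twins. If the union
had a window and no gap, then counting twin classes would yield monochromatic chains with steps of
at least `k` from one end of the path almost to the other. Their vertices are pairwise no twins, and
`n` is just too large for `k + 1` classes (`Coloring.exists_eq_zero`).

For `k = 1` the graph is the path on four vertices, treated directly at its last union. Minimality
follows since clique-width is at most linear clique-width. -/

namespace CliqueExpr

variable {V : Type*} {K : ℕ}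

/-! ### Labels and vertices of expressions -/

theorem HasLabel.mem_verts {e : CliqueExpr V K} {u : V} {a : Fin K} (h : e.HasLabel u a) :
    u ∈ e.verts := by
  induction e generalizing a with
  | vertex i v => exact h.1
  | union e f ihe ihf => exact h.imp (fun h => ihe h) (fun h => ihf h)
  | join i j e ih => exact ih h
  | relabel i j e ih => exact h.elim (fun h => ih h.1) (fun h => ih h.1)

theorem exists_hasLabel {e : CliqueExpr V K} {u : V} (h : u ∈ e.verts) : ∃ a, e.HasLabel u a := by
  induction e with
  | vertex i v => exact ⟨i, h, rfl⟩
  | union e f ihe ihf =>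
    rcases h with h | h
    · exact (ihe h).imp fun a ha => Or.inl ha
    · exact (ihf h).imp fun a ha => Or.inr ha
  | join i j e ih => exact ih h
  | relabel i j e ih =>
    obtain ⟨a, ha⟩ := ih h
    by_cases hai : a = i
    · exact ⟨j, Or.inr ⟨hai ▸ ha, rfl⟩⟩
    · exact ⟨a, Or.inl ⟨ha, hai⟩⟩

theorem HasLabel.unique {e : CliqueExpr V K} (he : e.WellFormed) {u : V} {a b : Fin K}
    (ha : e.HasLabel u a) (hb : e.HasLabel u b) : a = b := by
  induction e generalizing a b with
  | vertex i v => exact ha.2.trans hb.2.symm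
  | union e f ihe ihf =>
    obtain ⟨he, hf, hd⟩ := he
    rcases ha with ha | ha <;> rcases hb with hb | hb
    · exact ihe he ha hb
    · exact (Set.disjoint_left.1 hd ha.mem_verts hb.mem_verts).elim
    · exact (Set.disjoint_left.1 hd hb.mem_verts ha.mem_verts).elim
    · exact ihf hf ha hb
  | join i j e ih => exact ih he.2 ha hb
  | relabel i j e ih =>
    rcases ha with ⟨ha, hai⟩ | ⟨ha, rfl⟩ <;> rcases hb with ⟨hb, hbi⟩ | ⟨hb, rfl⟩
    · exact ih he ha hb
    · exact (hai (ih he ha hb)).elim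
    · exact (hbi (ih he hb ha)).elim
    · rfl

theorem mem_verts_of_adj {e : CliqueExpr V K} {u w : V} (h : e.graph.Adj u w) :
    u ∈ e.verts ∧ w ∈ e.verts := by
  induction e with
  | vertex i v => exact h.elim
  | union e f ihe ihf =>
    rcases h with h | h
    · exact ⟨Or.inl (ihe h).1, Or.inl (ihe h).2⟩
    · exact ⟨Or.inr (ihf h).1, Or.inr (ihf h).2⟩
  | join i j e ih =>
    rcases h with h | h
    · exact ih h
    · rcases h with ⟨-, ⟨h1, h2⟩ | ⟨h1, h2⟩⟩
      · exact ⟨h1.mem_verts, h2.mem_verts⟩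
      · exact ⟨h2.mem_verts, h1.mem_verts⟩
  | relabel i j e ih => exact ih h

/-! ### Linear expressions for induced subgraphs -/

/-- The linear expression `e` defines the subgraph of `G` induced by `P`, with labels `l`. -/
structure Builds (G : SimpleGraph V) (P : Set V) (l : V → Fin K) (e : CliqueExpr V K) : Prop where
  wellFormed : e.WellFormed
  isLinear : e.IsLinear
  verts_eq : e.verts = P
  hasLabel_iff : ∀ u a, e.HasLabel u a ↔ u ∈ P ∧ l u = a
  adj_iff : ∀ u w, e.graph.Adj u w ↔ u ∈ P ∧ w ∈ P ∧ G.Adj u w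

variable {G : SimpleGraph V} {P : Set V} {l : V → Fin K} {e : CliqueExpr V K}

theorem builds_vertex (G : SimpleGraph V) (z : V) (i : Fin K) :
    Builds G {z} (fun _ => i) (vertex i z) where
  wellFormed := trivial
  isLinear := trivial
  verts_eq := rfl
  hasLabel_iff u a := by
    change (u = z ∧ a = i) ↔ _
    simp [eq_comm]
  adj_iff u w := by
    simp only [graph, SimpleGraph.bot_adj, Set.mem_singleton_iff, false_iff]
    rintro ⟨rfl, rfl, h⟩
    exact h.ne rfl

theorem Builds.congr (h : Builds G P l e) {l' : V → Fin K} (hl : ∀ u ∈ P, l u = l' u) :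
    Builds G P l' e where
  wellFormed := h.wellFormed
  isLinear := h.isLinear
  verts_eq := h.verts_eq
  hasLabel_iff u a := by
    rw [h.hasLabel_iff]
    exact and_congr_right fun hu => by rw [hl u hu]
  adj_iff := h.adj_iff

open Classical in
theorem Builds.relabel (h : Builds G P l e) (i j : Fin K) :
    Builds G P (fun v => if l v = i then j else l v) (relabel i j e) where
  wellFormed := h.wellFormed
  isLinear := h.isLinear
  verts_eq := h.verts_eq
  hasLabel_iff u a := by
    change (e.HasLabel u a ∧ a ≠ i) ∨ (e.HasLabel u i ∧ a = j) ↔ _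
    simp only [h.hasLabel_iff]
    split_ifs with hi
    · constructor
      · rintro (⟨⟨h1, rfl⟩, h3⟩ | ⟨⟨h1, -⟩, rfl⟩)
        · exact (h3 hi).elim
        · exact ⟨h1, rfl⟩
      · rintro ⟨h1, rfl⟩
        exact Or.inr ⟨⟨h1, hi⟩, rfl⟩
    · constructor
      · rintro (⟨h1, -⟩ | ⟨⟨-, h2⟩, -⟩)
        · exact h1
        · exact (hi h2).elim
      · rintro ⟨h1, rfl⟩
        exact Or.inl ⟨⟨h1, rfl⟩, hi⟩
  adj_iff := h.adj_iff

open Classical in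
-- Labels can be changed one after the other in any order: a target `f i` is fixed by `f`, so it is
-- never moved later.
theorem Builds.exists_idempotent_relabel (h : Builds G P l e) (f : Fin K → Fin K)
    (hf : ∀ a, f (f a) = f a) : ∃ e' : CliqueExpr V K, Builds G P (fun v => f (l v)) e' := by
  have key : ∀ s : Finset (Fin K),
      ∃ e' : CliqueExpr V K, Builds G P (fun v => if l v ∈ s then f (l v) else l v) e' := by
    intro s
    induction s using Finset.induction_on with
    | empty => exact ⟨e, by simpa using h⟩
    | insert i s his ih =>
      obtain ⟨e', he'⟩ := ih
      by_cases hi : f i = i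
      · refine ⟨e', he'.congr fun u _ => ?_⟩
        by_cases h1 : l u = i
        · simp [h1, hi]
        · simp [h1]
      · refine ⟨_, (he'.relabel i (f i)).congr fun u _ => ?_⟩
        by_cases h1 : l u = i
        · simp [h1, his]
        · by_cases h2 : l u ∈ s
          · have h3 : f (l u) ≠ i := fun h3 => hi (by rw [← h3, hf])
            simp [h2, h3]
          · simp [h1, h2]
  obtain ⟨e', he'⟩ := key Finset.univ
  exact ⟨e', by simpa using he'⟩

theorem exists_join_finset (e : CliqueExpr V K) (i : Fin K) (T : Finset (Fin K)) (hi : i ∉ T)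
    (hw : e.WellFormed) (hl : e.IsLinear) :
    ∃ e' : CliqueExpr V K, e'.WellFormed ∧ e'.IsLinear ∧ e'.verts = e.verts ∧
      (∀ u a, e'.HasLabel u a ↔ e.HasLabel u a) ∧
      ∀ u w, e'.graph.Adj u w ↔ e.graph.Adj u w ∨ (u ≠ w ∧ ∃ b ∈ T,
        (e.HasLabel u i ∧ e.HasLabel w b) ∨ (e.HasLabel w i ∧ e.HasLabel u b)) := by
  induction T using Finset.induction_on with
  | empty => exact ⟨e, hw, hl, rfl, fun _ _ => Iff.rfl, by simp⟩
  | insert j T hj ih =>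
    obtain ⟨e', h1, h2, h3, h4, h5⟩ := ih fun h => hi (Finset.mem_insert_of_mem h)
    refine ⟨join i j e', ⟨?_, h1⟩, h2, h3, h4, fun u w => ?_⟩
    · rintro rfl
      exact hi (Finset.mem_insert_self _ _)
    · simp only [graph, SimpleGraph.sup_adj, SimpleGraph.fromRel_adj, h5, h4, Finset.mem_insert,
        exists_eq_or_imp]
      generalize (∃ b ∈ T, (e.HasLabel u i ∧ e.HasLabel w b) ∨
        (e.HasLabel w i ∧ e.HasLabel u b)) = X
      tauto

open Classical in
-- Create `z` with label `i` and join `i` to the labels of the neighbours of `z`. By `huni` these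
-- labels contain only neighbours of `z`; by `hshare` the older vertices labelled `i` gain no edge
-- that they should not have.
theorem Builds.exists_insert (h : Builds G P l e) {z : V} (hz : z ∉ P) (i : Fin K)
    (huni : ∀ u ∈ P, ∀ w ∈ P, l u = l w → (G.Adj u z ↔ G.Adj w z))
    (hshare : ∀ u ∈ P, l u = i → ¬ G.Adj u z ∧ ∀ w ∈ P, G.Adj w z → G.Adj u w) :
    ∃ e' : CliqueExpr V K, Builds G (insert z P) (Function.update l z i) e' := by
  set T : Finset (Fin K) := Finset.univ.filter fun b => ∃ w ∈ P, G.Adj w z ∧ l w = b with hT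
  have hiT : i ∉ T := by
    simp only [hT, Finset.mem_filter, Finset.mem_univ, true_and, not_exists, not_and]
    exact fun w hw hwz hwi => (hshare w hw hwi).1 hwz
  have hd : Disjoint (vertex i z : CliqueExpr V K).verts e.verts := by
    rw [h.verts_eq]
    exact Set.disjoint_singleton_left.2 hz
  have hlab : ∀ u a, (union (vertex i z) e).HasLabel u a ↔
      u ∈ insert z P ∧ Function.update l z i u = a := by
    intro u a
    change ((u = z ∧ a = i) ∨ e.HasLabel u a) ↔ _
    rw [h.hasLabel_iff]
    by_cases hu : u = z
    · subst hu
      simp [hz, eq_comm]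
    · simp [hu]
  obtain ⟨e', h1, h2, h3, h4, h5⟩ := exists_join_finset (union (vertex i z) e) i T hiT
    ⟨trivial, h.wellFormed, hd⟩ ⟨trivial, h.isLinear, Or.inl ⟨i, z, rfl⟩⟩
  refine ⟨e', h1, h2, ?_, fun u a => (h4 u a).trans (hlab u a), fun u w => ?_⟩
  · rw [h3]
    change {z} ∪ e.verts = _
    rw [h.verts_eq]
    rfl
  · have hne : ∀ {u}, u ∈ P → u ≠ z := fun hu h => hz (h ▸ hu)
    have hE : (union (vertex i z) e).graph.Adj u w ↔ u ∈ P ∧ w ∈ P ∧ G.Adj u w := by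
      rw [← h.adj_iff]
      simp [graph]
    have hTm : ∀ b, b ∈ T ↔ ∃ w ∈ P, G.Adj w z ∧ l w = b := by simp [hT]
    -- an edge added by a join is an edge of `G`
    have key : ∀ u w, u ∈ insert z P → w ∈ insert z P → Function.update l z i u = i →
        Function.update l z i w ∈ T → G.Adj u w := by
      intro u w hu hw hui hwT
      have hwz : w ≠ z := by
        rintro rfl
        rw [Function.update_self] at hwT
        exact hiT hwT
      have hwP : w ∈ P := hw.resolve_left hwz
      rw [Function.update_of_ne hwz, hTm] at hwT
      obtain ⟨w', hw', ha, hl⟩ := hwT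
      have hwa : G.Adj w z := (huni _ hw' _ hwP hl).1 ha
      by_cases huz : u = z
      · rw [huz]
        exact hwa.symm
      · rw [Function.update_of_ne huz] at hui
        exact (hshare u (hu.resolve_left huz) hui).2 w hwP hwa
    rw [h5, hE]
    simp only [hlab]
    constructor
    · rintro (⟨h1, h2, h3⟩ | ⟨-, b, hb, ⟨⟨h1, h2⟩, h3, h4⟩ | ⟨⟨h1, h2⟩, h3, h4⟩⟩)
      · exact ⟨Or.inr h1, Or.inr h2, h3⟩
      · exact ⟨h1, h3, key u w h1 h3 h2 (h4 ▸ hb)⟩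
      · exact ⟨h3, h1, (key w u h1 h3 h2 (h4 ▸ hb)).symm⟩
    · rintro ⟨hu, hw, ha⟩
      have hlz : Function.update l z i z = i := Function.update_self ..
      rcases hu with rfl | hu
      · have hw : w ∈ P := hw.resolve_left ha.ne'
        exact Or.inr ⟨ha.ne, l w, (hTm _).2 ⟨w, hw, ha.symm, rfl⟩,
          Or.inl ⟨⟨Or.inl rfl, hlz⟩, Or.inr hw, Function.update_of_ne (hne hw) ..⟩⟩
      · rcases hw with rfl | hw
        · exact Or.inr ⟨ha.ne, l u, (hTm _).2 ⟨u, hu, ha, rfl⟩,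
            Or.inr ⟨⟨Or.inl rfl, hlz⟩, Or.inr hu, Function.update_of_ne (hne hu) ..⟩⟩
        · exact Or.inl ⟨hu, hw, ha⟩

/-! ### Layouts: adding one vertex at a time -/

/-- Vertices with equal labels have the same neighbours in `F`. -/
def Uniform (G : SimpleGraph V) (P F : Set V) {α : Type*} (c : V → α) : Prop :=
  ∀ u ∈ P, ∀ w ∈ P, c u = c w → ∀ y ∈ F, (G.Adj u y ↔ G.Adj w y)

/-- Merging all labels whose vertices have the same neighbours in `F` makes the number of used
labels minimal, so that a bound on the number of classes frees a label. -/
theorem Builds.exists_canonical (h : Builds G P l e) {F : Set V} (hl : Uniform G P F l) :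
    ∃ (l' : V → Fin K) (e' : CliqueExpr V K), Builds G P l' e' ∧
      ∀ u ∈ P, ∀ w ∈ P, (l' u = l' w ↔ ∀ y ∈ F, (G.Adj u y ↔ G.Adj w y)) := by
  classical
  let g : Fin K → Set V := fun a => {y | y ∈ F ∧ ∃ v ∈ P, l v = a ∧ G.Adj v y}
  let f : Fin K → Fin K := fun a => (Quotient.mk (Setoid.ker g) a).out
  have hgf : ∀ a, g (f a) = g a := fun a =>
    Quotient.exact (Quotient.out_eq (Quotient.mk (Setoid.ker g) a))
  have hf : ∀ a b, f a = f b ↔ g a = g b := by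
    intro a b
    constructor
    · intro hab
      rw [← hgf a, hab, hgf b]
    · intro hab
      have : Quotient.mk (Setoid.ker g) a = Quotient.mk (Setoid.ker g) b := Quotient.sound hab
      simp only [f, this]
  obtain ⟨e', he'⟩ := h.exists_idempotent_relabel f fun a => (hf _ _).2 (hgf a)
  refine ⟨_, e', he', fun u hu w hw => ?_⟩
  rw [hf]
  have hg : ∀ v ∈ P, ∀ y, y ∈ g (l v) ↔ y ∈ F ∧ G.Adj v y := by
    intro v hv y
    constructor
    · rintro ⟨hy, v', hv', hl', ha⟩
      exact ⟨hy, (hl v' hv' v hv hl' y hy).1 ha⟩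
    · rintro ⟨hy, ha⟩
      exact ⟨hy, v, hv, rfl, ha⟩
  rw [Set.ext_iff]
  constructor
  · intro h y hy
    have := h y
    rw [hg u hu, hg w hw] at this
    tauto
  · intro h y
    rw [hg u hu, hg w hw]
    exact and_congr_right fun hy => h y hy

/-- The condition under which a vertex `z` can be added to the graph induced by `P` with `k + 1`
labels, when the vertices of `F` are added later: either the vertices of `P` fall into at most `k`
classes, or `z` can be given the label of a vertex of `P`. -/
def CanAdd (G : SimpleGraph V) (k : ℕ) (P : Set V) (z : V) (F : Set V) : Prop :=
  (∃ c : V → ℕ, (∀ u ∈ P, c u < k) ∧ Uniform G P (insert z F) c) ∨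
  ∃ u ∈ P, (∀ y ∈ F, (G.Adj u y ↔ G.Adj z y)) ∧
    ∀ u' ∈ P, (∀ y ∈ insert z F, (G.Adj u y ↔ G.Adj u' y)) →
      ¬ G.Adj u' z ∧ ∀ w ∈ P, G.Adj w z → G.Adj u' w

open Classical in
theorem Builds.exists_of_canAdd {k : ℕ} {l : V → Fin (k + 1)} {e : CliqueExpr V (k + 1)}
    (h : Builds G P l e) {z : V} {F : Set V} (hz : z ∉ P) (hl : Uniform G P (insert z F) l)
    (hc : CanAdd G k P z F) :
    ∃ (l' : V → Fin (k + 1)) (e' : CliqueExpr V (k + 1)), Builds G (insert z P) l' e' ∧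
      Uniform G (insert z P) F l' := by
  obtain ⟨l', e', he', hl'⟩ := h.exists_canonical hl
  have huni : ∀ u ∈ P, ∀ w ∈ P, l' u = l' w → (G.Adj u z ↔ G.Adj w z) :=
    fun u hu w hw huw => (hl' u hu w hw).1 huw z (Set.mem_insert _ _)
  have fin : ∀ i, (∀ u ∈ P, l' u = i → ¬ G.Adj u z ∧ ∀ w ∈ P, G.Adj w z → G.Adj u w) →
      (∀ u ∈ P, l' u = i → ∀ y ∈ F, (G.Adj u y ↔ G.Adj z y)) →
      ∃ (l' : V → Fin (k + 1)) (e' : CliqueExpr V (k + 1)), Builds G (insert z P) l' e' ∧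
      Uniform G (insert z P) F l' := by
    intro i hi1 hi2
    obtain ⟨e'', he''⟩ := he'.exists_insert hz i huni hi1
    refine ⟨_, e'', he'', ?_⟩
    have hne : ∀ {u}, u ∈ P → u ≠ z := fun hu h => hz (h ▸ hu)
    intro u hu w hw huw y hy
    rcases hu with rfl | hu <;> rcases hw with rfl | hw
    · exact Iff.rfl
    · rw [Function.update_self, Function.update_of_ne (hne hw)] at huw
      exact (hi2 w hw huw.symm y hy).symm
    · rw [Function.update_self, Function.update_of_ne (hne hu)] at huw
      exact hi2 u hu huw y hy
    · rw [Function.update_of_ne (hne hu), Function.update_of_ne (hne hw)] at huw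
      exact (hl' u hu w hw).1 huw y (Set.mem_insert_of_mem _ hy)
  rcases hc with ⟨c, hck, hcu⟩ | ⟨u, hu, hu1, hu2⟩
  -- If all `k + 1` canonical labels occurred, two of their vertices would agree under `c`, hence on
  -- their future neighbours, hence in their label.
  · obtain ⟨i, hi⟩ : ∃ i, ∀ u ∈ P, l' u ≠ i := by
      by_contra! hcon
      choose s hs hsl using hcon
      obtain ⟨a, b, hab, hcab⟩ := Fintype.exists_ne_map_eq_of_card_lt
        (fun a => (⟨c (s a), hck _ (hs a)⟩ : Fin k)) (by simp)
      have hcc : c (s a) = c (s b) := by simpa using hcab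
      have := (hl' _ (hs a) _ (hs b)).2 (hcu _ (hs a) _ (hs b) hcc)
      rw [hsl, hsl] at this
      exact hab this
    exact fin i (fun u hu h => (hi u hu h).elim) (fun u hu h => (hi u hu h).elim)
  · refine fin (l' u) (fun u' hu' h => hu2 u' hu' ((hl' u hu u' hu').1 h.symm)) ?_
    intro u' hu' h y hy
    rw [← hu1 y hy]
    exact (hl' u' hu' u hu).1 h y (Set.mem_insert_of_mem _ hy)

/-- A layout `t` of the vertices of `Q` all of whose steps satisfy `CanAdd` gives a linear
expression. -/
theorem exists_builds_of_layout {k : ℕ} (G : SimpleGraph V) (Q : Set V) (hQ : Q.Finite)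
    (hne : Q.Nonempty) (t : V → ℕ) (ht : Set.InjOn t Q)
    (hstep : ∀ z ∈ Q, CanAdd G k {u | u ∈ Q ∧ t u < t z} z {u | u ∈ Q ∧ t z < t u}) :
    ∃ (l : V → Fin (k + 1)) (e : CliqueExpr V (k + 1)), Builds G Q l e := by
  -- The first alternative covers the time before the first vertex, since no expression is empty.
  have key : ∀ m, (∀ u ∈ Q, m ≤ t u) ∨ ∃ (l : V → Fin (k + 1)) (e : CliqueExpr V (k + 1)),
      Builds G {u | u ∈ Q ∧ t u < m} l e ∧
        Uniform G {u | u ∈ Q ∧ t u < m} {u | u ∈ Q ∧ m ≤ t u} l := by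
    intro m
    induction m with
    | zero => exact Or.inl fun _ _ => Nat.zero_le _
    | succ m ih =>
      by_cases hm : ∃ z ∈ Q, t z = m
      · obtain ⟨z, hz, rfl⟩ := hm
        right
        have e1 : {u | u ∈ Q ∧ t u < t z + 1} = insert z {u | u ∈ Q ∧ t u < t z} := by
          ext u
          simp only [Set.mem_ofPred_eq, Set.mem_insert_iff]
          constructor
          · rintro ⟨hu, h⟩
            rcases (Nat.lt_succ_iff.1 h).lt_or_eq with h | h
            · exact Or.inr ⟨hu, h⟩
            · exact Or.inl (ht hu hz h)
          · rintro (rfl | ⟨hu, h⟩)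
            · exact ⟨hz, Nat.lt_succ_self _⟩
            · exact ⟨hu, h.trans (Nat.lt_succ_self _)⟩
        have e2 : {u | u ∈ Q ∧ t z ≤ t u} = insert z {u | u ∈ Q ∧ t z < t u} := by
          ext u
          simp only [Set.mem_ofPred_eq, Set.mem_insert_iff]
          constructor
          · rintro ⟨hu, h⟩
            rcases h.lt_or_eq with h | h
            · exact Or.inr ⟨hu, h⟩
            · exact Or.inl (ht hu hz h.symm)
          · rintro (rfl | ⟨hu, h⟩)
            · exact ⟨hz, le_rfl⟩
            · exact ⟨hu, h.le⟩
        rw [e1]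
        simp only [Nat.succ_le_iff]
        rcases ih with ih | ⟨l, e, hb, hu⟩
        · have e3 : {u | u ∈ Q ∧ t u < t z} = ∅ := by
            ext u
            simp only [Set.mem_ofPred_eq, Set.mem_empty_iff_false, iff_false, not_and, not_lt]
            exact ih u
          rw [e3]
          refine ⟨fun _ => 0, vertex 0 z, ?_, ?_⟩
          · rw [show insert z (∅ : Set V) = {z} by simp]
            exact builds_vertex G z 0
          · rintro u hu w hw - y -
            simp only [Set.mem_insert_iff, Set.mem_empty_iff_false, or_false] at hu hw
            rw [hu, hw]
        · rw [e2] at hu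
          exact hb.exists_of_canAdd (by simp) hu (hstep z hz)
      · have h1 : ∀ u ∈ Q, (t u < m + 1 ↔ t u < m) := fun u hu => by
          have : t u ≠ m := fun h => hm ⟨u, hu, h⟩
          omega
        have h2 : ∀ u ∈ Q, (m + 1 ≤ t u ↔ m ≤ t u) := fun u hu => by
          have := h1 u hu
          omega
        have e1 : {u | u ∈ Q ∧ t u < m + 1} = {u | u ∈ Q ∧ t u < m} :=
          Set.ext fun u => and_congr_right (h1 u)
        have e2 : {u | u ∈ Q ∧ m + 1 ≤ t u} = {u | u ∈ Q ∧ m ≤ t u} :=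
          Set.ext fun u => and_congr_right (h2 u)
        rw [e1, e2]
        exact ih.imp (fun ih u hu => (h2 u hu).2 (ih u hu)) id
  obtain ⟨m, hm⟩ := (hQ.image t).bddAbove
  have hm' : ∀ u ∈ Q, t u < m + 1 := fun u hu => Nat.lt_succ_of_le (hm ⟨u, hu, rfl⟩)
  rcases key (m + 1) with h | ⟨l, e, h, -⟩
  · obtain ⟨u, hu⟩ := hne
    exact absurd (h u hu) (not_le.2 (hm' u hu))
  · have : {u | u ∈ Q ∧ t u < m + 1} = Q := Set.ext fun u => ⟨fun h => h.1, fun h => ⟨h, hm' u h⟩⟩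
    exact ⟨l, e, this ▸ h⟩

/-! ### Restriction to a set of vertices -/

/-- An operand left without vertices has no expression, and then the union collapses to the other
operand. The clause on `IsVertex` carries linearity through the induction. -/
theorem exists_restrict (S : Set V) (e : CliqueExpr V K) :
    Disjoint e.verts S ∨ ∃ e' : CliqueExpr S K,
      (∀ u : S, u ∈ e'.verts ↔ (u : V) ∈ e.verts) ∧
      (∀ (u : S) a, e'.HasLabel u a ↔ e.HasLabel u a) ∧
      (∀ u w : S, e'.graph.Adj u w ↔ e.graph.Adj u w) ∧
      (e.WellFormed → e'.WellFormed) ∧ (e.IsLinear → e'.IsLinear) ∧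
      (e.IsVertex → e'.IsVertex) := by
  induction e with
  | vertex i v =>
    by_cases hv : v ∈ S
    · refine Or.inr ⟨vertex i ⟨v, hv⟩, fun u => ?_, fun u a => ?_, fun u w => ?_, fun _ => trivial,
        fun _ => trivial, fun _ => ⟨_, _, rfl⟩⟩
      · simp [verts, Subtype.ext_iff]
      · simp [HasLabel, Subtype.ext_iff]
      · simp [graph]
    · exact Or.inl (Set.disjoint_singleton_left.2 hv)
  | join i j e ih =>
    refine ih.imp id ?_
    rintro ⟨e', h1, h2, h3, h4, h5, -⟩
    refine ⟨join i j e', h1, h2, fun u w => ?_, fun h => ⟨h.1, h4 h.2⟩, h5, ?_⟩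
    · simp [graph, h2, h3, Subtype.ext_iff]
    · rintro ⟨_, _, h⟩
      cases h
  | relabel i j e ih =>
    refine ih.imp id ?_
    rintro ⟨e', h1, h2, h3, h4, h5, -⟩
    refine ⟨relabel i j e', h1, fun u a => ?_, h3, h4, h5, ?_⟩
    · simp [HasLabel, h2]
    · rintro ⟨_, _, h⟩
      cases h
  | union e f ihe ihf =>
    rcases ihe with he | ⟨e', h1, h2, h3, h4, h5, h6⟩
    · rcases ihf with hf | ⟨f', g1, g2, g3, g4, g5, g6⟩
      · exact Or.inl (Set.disjoint_union_left.2 ⟨he, hf⟩)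
      · have he' : ∀ u : S, (u : V) ∉ e.verts := fun u hu => Set.disjoint_left.1 he hu u.2
        refine Or.inr ⟨f', fun u => ?_, fun u a => ?_, fun u w => ?_, fun h => g4 h.2.1,
          fun h => g5 h.2.1, ?_⟩
        · simp [verts, g1, he']
        · have : ¬ e.HasLabel u a := fun h => he' u h.mem_verts
          simp [HasLabel, g2, this]
        · have : ¬ e.graph.Adj u w := fun h => he' u (mem_verts_of_adj h).1
          simp [graph, g3, this]
        · rintro ⟨_, _, h⟩
          cases h
    · rcases ihf with hf | ⟨f', g1, g2, g3, g4, g5, g6⟩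
      · have hf' : ∀ u : S, (u : V) ∉ f.verts := fun u hu => Set.disjoint_left.1 hf hu u.2
        refine Or.inr ⟨e', fun u => ?_, fun u a => ?_, fun u w => ?_, fun h => h4 h.1,
          fun h => h5 h.1, ?_⟩
        · simp [verts, h1, hf']
        · have : ¬ f.HasLabel u a := fun h => hf' u h.mem_verts
          simp [HasLabel, h2, this]
        · have : ¬ f.graph.Adj u w := fun h => hf' u (mem_verts_of_adj h).1
          simp [graph, h3, this]
        · rintro ⟨_, _, h⟩
          cases h
      · refine Or.inr ⟨union e' f', fun u => ?_, fun u a => ?_, fun u w => ?_,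
          fun h => ⟨h4 h.1, g4 h.2.1, ?_⟩, fun h => ⟨h5 h.1, g5 h.2.1, h.2.2.imp h6 g6⟩, ?_⟩
        · simp [verts, h1, g1]
        · simp [HasLabel, h2, g2]
        · simp [graph, h3, g3]
        · rw [Set.disjoint_left]
          intro u hu hu'
          exact Set.disjoint_left.1 h.2.2 ((h1 u).1 hu) ((g1 u).1 hu')
        · rintro ⟨_, _, h⟩
          cases h

theorem Builds.linearCliqueWidth_induce_le (h : Builds G P l e) {S : Set V} (hS : S ⊆ P) :
    linearCliqueWidth (G.induce S) ≤ K := by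
  refine sInf_le ⟨K, rfl, ?_⟩
  rcases exists_restrict S e with hd | ⟨e', h1, -, h3, h4, h5, -⟩
  · left
    refine ⟨fun u => Set.disjoint_left.1 hd ?_ u.2⟩
    rw [h.verts_eq]
    exact hS u.2
  · refine Or.inr ⟨e', h5 h.isLinear, h4 h.wellFormed, ?_, ?_⟩
    · rw [Set.eq_univ_iff_forall]
      intro u
      rw [h1, h.verts_eq]
      exact hS u.2
    · ext u w
      rw [h3, h.adj_iff]
      simp [hS u.2, hS w.2]

end CliqueExpr

/-! ### Layouts of path powers with a deleted vertex -/

theorem mul_add_lt_mul_add_iff {n a a' b b' : ℕ} (hb : b < n) (hb' : b' < n) :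
    a * n + b < a' * n + b' ↔ a < a' ∨ (a = a' ∧ b < b') := by
  rcases lt_trichotomy a a' with h | rfl | h
  · have : (a + 1) * n ≤ a' * n := Nat.mul_le_mul_right _ h
    rw [add_mul, one_mul] at this
    simp only [h, true_or, iff_true]
    omega
  · simp
  · have : (a' + 1) * n ≤ a * n := Nat.mul_le_mul_right _ h
    rw [add_mul, one_mul] at this
    constructor
    · intro h'
      omega
    · rintro (h' | ⟨h', -⟩) <;> omega

/-- Adjacency of the vertices in row `r` of column `c` and in row `r'` of column `c'`, for columns
of `k + 1` consecutive vertices. -/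
def ColAdj (c r c' r' : ℕ) : Prop :=
  (c = c' ∧ r ≠ r') ∨ (c' = c + 1 ∧ r' < r) ∨ (c = c' + 1 ∧ r < r')

/-- The rank of the diagonal of a vertex on the right (`b = true`) or left of the deleted vertex. -/
def diagRank (k : ℕ) (b : Bool) (c r : ℕ) : ℕ :=
  if b then 2 * k + 2 - (c + r) else 2 * k + 3 + (c + r)

/-- The rank of a vertex in its diagonal. -/
def posRank (k : ℕ) (b : Bool) (c r : ℕ) : ℕ :=
  if (if b then k ≤ c + r else c + r < k) then c else k - c

/-- The label of the processed vertex `(b, c, r)` before a right vertex `(m, q)` is added. -/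
def rightLabel (k m q c r : ℕ) : ℕ :=
  if k ≤ m + q then c
  else if c = m + 1 ∧ r + m + 1 = m + q then m + q
  else if c = 0 ∧ r + 1 ≤ k then r
  else if c + 2 ≤ m + q then c
  else if c + 1 = m + q ∧ c = m then m + q
  else m + q - 1

/-- The label of the processed vertex `(b, c, r)` before a left vertex `(m, q)` is added. -/
def leftLabel (k m q : ℕ) (b : Bool) (c r : ℕ) : ℕ :=
  if m + q < k then
    if b then
      if c = 0 ∧ r + 1 + (if m = 0 then m + q - 1 else m + q) ≤ k then k - r else m + q - 1
    else if c + 1 = m ∧ r + m = m + q + 1 then m + q else c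
  else if b then k - 1 else c

/-- `(b, c, r)` comes before `(b', c', r')` in the layout. -/
def Before (k : ℕ) (b : Bool) (c r : ℕ) (b' : Bool) (c' r' : ℕ) : Prop :=
  diagRank k b c r < diagRank k b' c' r' ∨
    (diagRank k b c r = diagRank k b' c' r' ∧ posRank k b c r < posRank k b' c' r')

theorem before_right_iff {k c r m q : ℕ} (hm : m < k) (hq : q ≤ k + 1) (hc : c < k)
    (hr : r ≤ k + 1) : Before k true c r true m q ↔
      m + q < c + r ∨ (m + q = c + r ∧ ((k ≤ m + q ∧ c < m) ∨ (m + q < k ∧ m < c))) := by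
  unfold Before diagRank posRank
  simp only [if_true]
  split_ifs <;> omega

theorem before_left_iff {k c r m q : ℕ} (hm : m < k) (hc : c < k) :
    Before k false c r false m q ↔
      c + r < m + q ∨ (m + q = c + r ∧ ((k ≤ m + q ∧ m < c) ∨ (m + q < k ∧ c < m))) := by
  unfold Before diagRank posRank
  simp only [if_false, Bool.false_eq_true]
  split_ifs <;> omega

theorem before_right_left {k c r m q : ℕ} : Before k true c r false m q := by
  unfold Before diagRank
  simp only [if_true, if_false, Bool.false_eq_true]
  omega

theorem not_before_left_right {k c r m q : ℕ} : ¬ Before k false c r true m q := by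
  unfold Before diagRank
  simp only [if_true, if_false, Bool.false_eq_true]
  omega

/-- The count behind `rightLabel`. While `k ≤ m + q`, the created part of a column is one class.
Afterwards the created rows `r < k` of column 0, all with `r > m + q`, need labels of their own
because of their left neighbours. Columns up to `m + q - 2` keep their number, those without right
neighbours to come share `m + q - 1`, and `m + q` is left for one exceptional class: `(m + 1, q -
1)`, or column `m` if `q = 1`. -/
theorem rightLabel_lt {k m q c r : ℕ} (hq : 1 ≤ q ∧ q ≤ k + 1) (hc : c < k) :
    rightLabel k m q c r < k := by
  unfold rightLabel
  split_ifs <;> omega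

set_option maxHeartbeats 1000000 in
/-- Right vertices with equal labels have the same right neighbours among those still to come. -/
theorem colAdj_of_rightLabel_eq {k m q c r c' r' d s : ℕ}
    (hm : m < k) (hq : 1 ≤ q ∧ q ≤ k + 1) (hc : c < k) (hr : 1 ≤ r ∧ r ≤ k + 1)
    (hc' : c' < k) (hr' : 1 ≤ r' ∧ r' ≤ k + 1) (hd : d < k) (hs : 1 ≤ s ∧ s ≤ k + 1)
    (h : Before k true c r true m q) (h' : Before k true c' r' true m q)
    (hy : ¬ Before k true d s true m q) (hl : rightLabel k m q c r = rightLabel k m q c' r')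
    (ha : ColAdj c r d s) : ColAdj c' r' d s := by
  rw [before_right_iff hm hq.2 hc hr.2] at h
  rw [before_right_iff hm hq.2 hc' hr'.2] at h'
  rw [before_right_iff hm hq.2 hd hs.2] at hy
  unfold rightLabel at hl
  unfold ColAdj at *
  by_cases h1 : k ≤ m + q
  · simp only [h1, if_true] at hl
    subst hl
    have e1 : (c < m ∧ m + q ≤ c + r) ∨ (m ≤ c ∧ m + q < c + r) := by omega
    have e2 : (c < m ∧ m + q ≤ c + r') ∨ (m ≤ c ∧ m + q < c + r') := by omega
    have e3 : (d < m ∧ d + s < m + q) ∨ (m ≤ d ∧ d + s ≤ m + q) := by omega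
    clear h h' hy
    omega
  · simp only [h1, if_false] at hl
    have e1 : (m < c ∧ m + q ≤ c + r) ∨ (c ≤ m ∧ m + q < c + r) := by omega
    have e2 : (m < c' ∧ m + q ≤ c' + r') ∨ (c' ≤ m ∧ m + q < c' + r') := by omega
    have e3 : (m < d ∧ d + s < m + q) ∨ (d ≤ m ∧ d + s ≤ m + q) := by omega
    clear h h' hy
    rcases ha with ⟨rfl, ha⟩ | ⟨rfl, ha⟩ | ⟨rfl, ha⟩ <;> rcases e3 with e3 | e3 <;>
      rcases e2 with e2 | e2 <;> split_ifs at hl <;> lia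

/-- Right vertices with equal labels have the same left neighbours. -/
theorem cross_of_rightLabel_eq {k m q c r c' r' : ℕ}
    (hm : m < k) (hq : 1 ≤ q ∧ q ≤ k + 1) (hc : c < k) (hr : 1 ≤ r ∧ r ≤ k + 1)
    (hc' : c' < k) (hr' : 1 ≤ r' ∧ r' ≤ k + 1)
    (h : Before k true c r true m q) (h' : Before k true c' r' true m q)
    (hl : rightLabel k m q c r = rightLabel k m q c' r') (h1 : r + 1 ≤ k) (h2 : c = 0) :
    c' = 0 ∧ r' = r := by
  rw [before_right_iff hm hq.2 hc hr.2] at h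
  rw [before_right_iff hm hq.2 hc' hr'.2] at h'
  unfold rightLabel at hl
  split_ifs at hl <;> omega

/-- While `m + q < k`, left columns use labels up to `m + q - 2`, right vertices without left
neighbours to come share `m + q - 1`, the preceding vertex `(m - 1, q + 1)` of the diagonal has `m +
q`, and any other right vertex has the number `k - r` of the last left row within its reach. If `m =
0`, there is no preceding vertex on the diagonal, and `m + q` is itself such a number. -/
theorem leftLabel_lt {k m q c r : ℕ} {b : Bool} (hq : 1 ≤ q ∧ q ≤ k + 1)
    (hc : c < k) (hr : 1 ≤ r) : leftLabel k m q b c r < k := by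
  unfold leftLabel
  split_ifs <;> omega

/-- Left vertices with equal labels have the same neighbours among those still to come. -/
theorem colAdj_of_leftLabel_eq {k m q c r c' r' d s : ℕ}
    (hm : m < k) (hq : 1 ≤ q ∧ q ≤ k + 1) (hc : c < k) (hr : 1 ≤ r ∧ r ≤ k + 1)
    (hc' : c' < k) (hr' : 1 ≤ r' ∧ r' ≤ k + 1) (hd : d < k)
    (h : Before k false c r false m q) (h' : Before k false c' r' false m q)
    (hy : ¬ Before k false d s false m q)
    (hl : leftLabel k m q false c r = leftLabel k m q false c' r')
    (ha : ColAdj c r d s) : ColAdj c' r' d s := by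
  rw [before_left_iff hm hc] at h
  rw [before_left_iff hm hc'] at h'
  rw [before_left_iff hm hd] at hy
  unfold leftLabel at hl
  simp only [if_false, Bool.false_eq_true] at hl
  unfold ColAdj at *
  by_cases h1 : m + q < k
  · simp only [h1, if_true] at hl
    have e1 : (c < m ∧ c + r ≤ m + q) ∨ (m ≤ c ∧ c + r < m + q) := by omega
    have e2 : (c' < m ∧ c' + r' ≤ m + q) ∨ (m ≤ c' ∧ c' + r' < m + q) := by omega
    have e3 : (d < m ∧ m + q < d + s) ∨ (m ≤ d ∧ m + q ≤ d + s) := by omega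
    clear h h' hy
    split_ifs at hl <;> omega
  · simp only [h1, if_false] at hl
    have e1 : (m < c ∧ c + r ≤ m + q) ∨ (c ≤ m ∧ c + r < m + q) := by omega
    have e2 : (m < c' ∧ c' + r' ≤ m + q) ∨ (c' ≤ m ∧ c' + r' < m + q) := by omega
    have e3 : (m < d ∧ m + q < d + s) ∨ (d ≤ m ∧ m + q ≤ d + s) := by omega
    clear h h' hy
    omega

/-- A right vertex and a vertex with an equal label have the same left neighbours among those
still to come. -/
theorem cross_of_leftLabel_eq {k m q c r c' r' d s : ℕ}
    (hm : m < k) (hq : 1 ≤ q ∧ q ≤ k + 1) (hr : 1 ≤ r)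
    (hd : d < k)
    (hy : ¬ Before k false d s false m q)
    (hl : leftLabel k m q true c r = leftLabel k m q true c' r')
    (ha : c = 0 ∧ d = 0 ∧ r + s ≤ k) : c' = 0 ∧ d = 0 ∧ r' + s ≤ k := by
  rw [before_left_iff hm hd] at hy
  unfold leftLabel at hl
  simp only [if_true] at hl
  split_ifs at hl <;> omega

/-- A right vertex and a left vertex have distinct labels. -/
theorem leftLabel_right_ne_left {k m q c r c' r' : ℕ}
    (hm : m < k) (hq : 1 ≤ q ∧ q ≤ k + 1) (hc' : c' + 2 ≤ k) (hr' : 1 ≤ r')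
    (h' : Before k false c' r' false m q)
    (hl : leftLabel k m q true c r = leftLabel k m q false c' r') : False := by
  rw [before_left_iff hm (by omega)] at h'
  unfold leftLabel at hl
  simp only [if_true, if_false, Bool.false_eq_true] at hl
  split_ifs at hl <;> omega
open CliqueExpr

/-- `R` marks the right side; columns and rows are counted from the deleted vertex. By `hleft` the
left columns avoid the label `k - 1`, which all right vertices share once `k ≤ m + q`. -/
theorem exists_builds_of_columns {V : Type*} {k : ℕ} (G : SimpleGraph V) (Q : Set V)
    (hQ : Q.Finite) (hne : Q.Nonempty) (R : V → Bool) (c r : V → ℕ)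
    (hinj : ∀ u ∈ Q, ∀ w ∈ Q, R u = R w → c u = c w → r u = r w → u = w)
    (hr : ∀ u ∈ Q, 1 ≤ r u ∧ r u ≤ k + 1) (hc : ∀ u ∈ Q, c u < k)
    (hleft : ∀ u ∈ Q, ∀ w ∈ Q, R u = false → R w = false → u ≠ w → c u + 2 ≤ k)
    (hsame : ∀ u ∈ Q, ∀ w ∈ Q, R u = R w → (G.Adj u w ↔ ColAdj (c u) (r u) (c w) (r w)))
    (hcross : ∀ u ∈ Q, ∀ w ∈ Q, R u = true → R w = false →
      (G.Adj u w ↔ c u = 0 ∧ c w = 0 ∧ r u + r w ≤ k)) :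
    ∃ (l : V → Fin (k + 1)) (e : CliqueExpr V (k + 1)), Builds G Q l e := by
  let t : V → ℕ := fun u => diagRank k (R u) (c u) (r u) * (k + 1) + posRank k (R u) (c u) (r u)
  have hpos : ∀ u ∈ Q, posRank k (R u) (c u) (r u) < k + 1 := by
    intro u hu
    have := hc u hu
    unfold posRank
    split_ifs <;> omega
  have hlt : ∀ u ∈ Q, ∀ w ∈ Q, t u < t w ↔ Before k (R u) (c u) (r u) (R w) (c w) (r w) :=
    fun u hu w hw => mul_add_lt_mul_add_iff (hpos u hu) (hpos w hw)
  refine exists_builds_of_layout G Q hQ hne t ?_ ?_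
  · intro u hu w hw huw
    have h1 : ¬ Before k (R u) (c u) (r u) (R w) (c w) (r w) := by
      rw [← hlt u hu w hw]
      exact huw.not_lt
    have h2 : ¬ Before k (R w) (c w) (r w) (R u) (c u) (r u) := by
      rw [← hlt w hw u hu]
      exact huw.not_gt
    have a1 := hc u hu
    have a2 := hc w hw
    have a3 := hr u hu
    have a4 := hr w hw
    cases hRu : R u <;> cases hRw : R w <;> rw [hRu, hRw] at h1 h2
    · rw [before_left_iff a2 a1] at h1
      rw [before_left_iff a1 a2] at h2
      exact hinj u hu w hw (hRu.trans hRw.symm) (by omega) (by omega)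
    · exact (h2 before_right_left).elim
    · exact (h1 before_right_left).elim
    · rw [before_right_iff a2 a4.2 a1 a3.2] at h1
      rw [before_right_iff a1 a3.2 a2 a4.2] at h2
      exact hinj u hu w hw (hRu.trans hRw.symm) (by omega) (by omega)
  · intro z hz
    -- On this layout there are at most `k` classes at every step, so no label is ever reused.
    left
    have hF : ∀ y ∈ insert z {u | u ∈ Q ∧ t z < t u},
        y ∈ Q ∧ ¬ Before k (R y) (c y) (r y) (R z) (c z) (r z) := by
      rintro y (rfl | ⟨hy, hlt'⟩)
      · exact ⟨hz, by rw [← hlt y hz y hz]; exact lt_irrefl _⟩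
      · exact ⟨hy, by rw [← hlt y hy z hz]; exact hlt'.not_gt⟩
    have hP : ∀ u ∈ {u | u ∈ Q ∧ t u < t z},
        u ∈ Q ∧ Before k (R u) (c u) (r u) (R z) (c z) (r z) :=
      fun u hu => ⟨hu.1, (hlt u hu.1 z hz).1 hu.2⟩
    cases hRz : R z <;> rw [hRz] at hF hP
    · refine ⟨fun u => leftLabel k (c z) (r z) (R u) (c u) (r u), fun u hu =>
        leftLabel_lt (hr z hz) (hc u hu.1) (hr u hu.1).1, ?_⟩
      suffices H : ∀ u ∈ {u | u ∈ Q ∧ t u < t z}, ∀ w ∈ {u | u ∈ Q ∧ t u < t z},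
          leftLabel k (c z) (r z) (R u) (c u) (r u) = leftLabel k (c z) (r z) (R w) (c w) (r w) →
          ∀ y ∈ insert z {u | u ∈ Q ∧ t z < t u}, G.Adj u y → G.Adj w y from
        fun u hu w hw h y hy => ⟨H u hu w hw h y hy, H w hw u hu h.symm y hy⟩
      intro u hu w hw h y hy ha
      obtain ⟨hu, hub⟩ := hP u hu
      obtain ⟨hw, hwb⟩ := hP w hw
      obtain ⟨hy, hyb⟩ := hF y hy
      have hRy : R y = false := by
        cases hRy : R y
        · rfl
        · rw [hRy] at hyb
          exact (hyb before_right_left).elim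
      rw [hRy] at hyb
      cases hRu : R u <;> cases hRw : R w <;> rw [hRu] at hub h <;> rw [hRw] at hwb h
      · rw [hsame u hu y hy (hRu.trans hRy.symm)] at ha
        rw [hsame w hw y hy (hRw.trans hRy.symm)]
        exact colAdj_of_leftLabel_eq (hc z hz) (hr z hz) (hc u hu) (hr u hu) (hc w hw) (hr w hw)
          (hc y hy) hub hwb hyb h ha
      · have hne : u ≠ z := by
          intro h0
          rw [h0, before_left_iff (hc z hz) (hc z hz)] at hub
          omega
        exact (leftLabel_right_ne_left (hc z hz) (hr z hz) (hleft u hu z hz hRu hRz hne)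
          (hr u hu).1 hub h.symm).elim
      · have hne : w ≠ z := by
          intro h0
          rw [h0, before_left_iff (hc z hz) (hc z hz)] at hwb
          omega
        exact (leftLabel_right_ne_left (hc z hz) (hr z hz) (hleft w hw z hz hRw hRz hne)
          (hr w hw).1 hwb h).elim
      · rw [hcross u hu y hy hRu hRy] at ha
        rw [hcross w hw y hy hRw hRy]
        exact cross_of_leftLabel_eq (hc z hz) (hr z hz) (hr u hu).1 (hc y hy) hyb h ha
    · have hPR : ∀ u ∈ {u | u ∈ Q ∧ t u < t z}, R u = true := by
        intro u hu
        have := (hP u hu).2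
        cases hRu : R u
        · rw [hRu] at this
          exact (not_before_left_right this).elim
        · rfl
      refine ⟨fun u => rightLabel k (c z) (r z) (c u) (r u), fun u hu =>
        rightLabel_lt (hr z hz) (hc u hu.1), ?_⟩
      suffices H : ∀ u ∈ {u | u ∈ Q ∧ t u < t z}, ∀ w ∈ {u | u ∈ Q ∧ t u < t z},
          rightLabel k (c z) (r z) (c u) (r u) = rightLabel k (c z) (r z) (c w) (r w) →
          ∀ y ∈ insert z {u | u ∈ Q ∧ t z < t u}, G.Adj u y → G.Adj w y from
        fun u hu w hw h y hy => ⟨H u hu w hw h y hy, H w hw u hu h.symm y hy⟩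
      intro u hu w hw h y hy ha
      have hRu := hPR u hu
      have hRw := hPR w hw
      obtain ⟨hu, hub⟩ := hP u hu
      obtain ⟨hw, hwb⟩ := hP w hw
      obtain ⟨hy, hyb⟩ := hF y hy
      rw [hRu] at hub
      rw [hRw] at hwb
      cases hRy : R y <;> rw [hRy] at hyb
      · rw [hcross u hu y hy hRu hRy] at ha
        rw [hcross w hw y hy hRw hRy]
        have := (hr y hy).1
        obtain ⟨h1, h2⟩ := cross_of_rightLabel_eq (hc z hz) (hr z hz) (hc u hu) (hr u hu) (hc w hw)
          (hr w hw) hub hwb h (by omega) ha.1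
        exact ⟨h1, ha.2.1, by omega⟩
      · rw [hsame u hu y hy (hRu.trans hRy.symm)] at ha
        rw [hsame w hw y hy (hRw.trans hRy.symm)]
        exact colAdj_of_rightLabel_eq (hc z hz) (hr z hz) (hc u hu) (hr u hu) (hc w hw) (hr w hw)
          (hc y hy) (hr y hy) hub hwb hyb h ha

/-! ### Deleted end vertex: layout by rows -/

/-- A linear expression for columns of `k + 1` consecutive vertices with one more vertex `z` at
their beginning. -/
theorem exists_builds_of_rows {V : Type*} {k : ℕ} (G : SimpleGraph V) (Q : Set V)
    (hQ : Q.Finite) (z : V) (hzQ : z ∈ Q) (c r : V → ℕ)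
    (hinj : ∀ u ∈ Q, ∀ w ∈ Q, u ≠ z → w ≠ z → c u = c w → r u = r w → u = w)
    (hr : ∀ u ∈ Q, u ≠ z → 1 ≤ r u ∧ r u ≤ k + 1) (hc : ∀ u ∈ Q, u ≠ z → c u < k)
    (hsame : ∀ u ∈ Q, ∀ w ∈ Q, u ≠ z → w ≠ z →
      (G.Adj u w ↔ ColAdj (c u) (r u) (c w) (r w)))
    (hz : ∀ u ∈ Q, u ≠ z → (G.Adj u z ↔ c u = 0 ∧ r u ≤ k))
    (hlast : ∀ u ∈ Q, u ≠ z → ∃ w ∈ Q, w ≠ z ∧ c w = c u ∧ r w = k + 1)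
    (hfirst : ∀ u ∈ Q, u ≠ z → ∃ w ∈ Q, w ≠ z ∧ c w = 0 ∧ r w = k + 1) :
    ∃ (l : V → Fin (k + 1)) (e : CliqueExpr V (k + 1)), Builds G Q l e := by
  classical
  -- In the last row the place 1 is reserved for `z`, directly after column 0; the later columns
  -- move up by one.
  let row : V → ℕ := fun u => if u = z then k else r u - 1
  let col : V → ℕ := fun u => if u = z then 1 else if r u = k + 1 ∧ 1 ≤ c u then c u + 1 else c u
  let t : V → ℕ := fun u => row u * (k + 2) + col u
  have hcol : ∀ u ∈ Q, col u < k + 2 := by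
    intro u hu
    by_cases huz : u = z
    · simp [col, huz]
    · have := hc u hu huz
      simp only [col, huz, if_false]
      split_ifs <;> omega
  have hlt : ∀ u ∈ Q, ∀ w ∈ Q, t u < t w ↔ row u < row w ∨ (row u = row w ∧ col u < col w) :=
    fun u hu w hw => mul_add_lt_mul_add_iff (hcol u hu) (hcol w hw)
  have hlt1 : ∀ u ∈ Q, ∀ w ∈ Q, u ≠ z → w ≠ z →
      (t u < t w ↔ r u < r w ∨ (r u = r w ∧ c u < c w)) := by
    intro u hu w hw huz hwz
    have := hr u hu huz
    have := hr w hw hwz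
    rw [hlt u hu w hw]
    simp only [row, col, huz, hwz, if_false]
    split_ifs <;> omega
  have hlt2 : ∀ u ∈ Q, u ≠ z → (t u < t z ↔ r u ≤ k ∨ c u = 0) := by
    intro u hu huz
    have := hr u hu huz
    rw [hlt u hu z hzQ]
    simp only [row, col, huz, if_false, if_true]
    split_ifs <;> omega
  have hlt3 : ∀ u ∈ Q, u ≠ z → (t z < t u ↔ r u = k + 1 ∧ 1 ≤ c u) := by
    intro u hu huz
    have := hr u hu huz
    rw [hlt z hzQ u hu]
    simp only [row, col, huz, if_false, if_true]
    split_ifs <;> omega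
  refine exists_builds_of_layout G Q hQ ⟨z, hzQ⟩ t ?_ ?_
  · intro u hu w hw huw
    by_cases huz : u = z <;> by_cases hwz : w = z
    · rw [huz, hwz]
    · have h1 := hlt2 w hw hwz
      have h2 := hlt3 w hw hwz
      have := hr w hw hwz
      rw [huz] at huw
      omega
    · have h1 := hlt2 u hu huz
      have h2 := hlt3 u hu huz
      have := hr u hu huz
      rw [hwz] at huw
      omega
    · have h1 := hlt1 u hu w hw huz hwz
      have h2 := hlt1 w hw u hu hwz huz
      exact hinj u hu w hw huz hwz (by omega) (by omega)
  · intro x hx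
    by_cases hxz : x = z
    · subst hxz
      by_cases hP : ∃ u ∈ Q, u ≠ x
      · obtain ⟨u, hu, hux⟩ := hP
        -- The extra vertex takes the label of `w`, the last vertex of column 0: neither of them has
        -- a neighbour still to come.
        obtain ⟨w, hw, hwx, hw0, hwr⟩ := hfirst u hu hux
        have hwx' : ¬ G.Adj w x := by
          rw [hz w hw hwx]
          omega
        have hnx : ∀ y ∈ {u | u ∈ Q ∧ t x < t u}, ¬ G.Adj x y ∧ ¬ G.Adj w y := by
          rintro y ⟨hy, hyx⟩
          have hne : y ≠ x := fun h => hyx.ne (by rw [h])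
          rw [hlt3 y hy hne] at hyx
          rw [G.adj_comm x y, hz y hy hne, hsame w hw y hy hwx hne]
          unfold ColAdj
          omega
        refine Or.inr ⟨w, ⟨hw, by rw [hlt2 w hw hwx]; exact Or.inr hw0⟩,
          fun y hy => iff_of_false (hnx y hy).2 (hnx y hy).1, ?_⟩
        rintro v ⟨hv, hvx⟩ hvy
        have hne : v ≠ x := fun h => hvx.ne (by rw [h])
        have hvx' : ¬ G.Adj v x := fun h => hwx' ((hvy x (Set.mem_insert _ _)).2 h)
        refine ⟨hvx', ?_⟩
        -- Outside column 0, `v` would be adjacent to the last vertex of its column, which is still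
        -- to come and not adjacent to `w`.
        have hv0 : c v = 0 := by
          by_contra hv0
          obtain ⟨y, hy, hyx, hyc, hyr⟩ := hlast v hv hne
          have hty : t x < t y := by
            rw [hlt3 y hy hyx]
            omega
          refine (hnx y ⟨hy, hty⟩).2 ((hvy y (Set.mem_insert_of_mem _ ⟨hy, hty⟩)).2 ?_)
          rw [hlt2 v hv hne] at hvx
          rw [hsame v hv y hy hne hyx]
          unfold ColAdj
          omega
        rintro s ⟨hs, hsx⟩ hsa
        have hsne : s ≠ x := hsa.ne
        rw [hz s hs hsne] at hsa
        rw [hz v hv hne] at hvx'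
        rw [hsame v hv s hs hne hsne]
        unfold ColAdj
        omega
      · push Not at hP
        refine Or.inl ⟨fun _ => 0, ?_, ?_⟩
        · rintro u ⟨hu, h⟩
          exact (h.ne (by rw [hP u hu])).elim
        · rintro u ⟨hu, h⟩
          exact (h.ne (by rw [hP u hu])).elim
    · refine Or.inl ⟨fun u => if u = z then 0 else c u, ?_, ?_⟩
      · rintro u ⟨hu, -⟩
        have := hc x hx hxz
        by_cases huz : u = z
        · simp only [huz, if_true]
          omega
        · simp only [huz, if_false]
          exact hc u hu huz
      · suffices H : ∀ u ∈ {u | u ∈ Q ∧ t u < t x}, ∀ w ∈ {u | u ∈ Q ∧ t u < t x},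
            (if u = z then 0 else c u) = (if w = z then 0 else c w) →
            ∀ y ∈ insert x {u | u ∈ Q ∧ t x < t u}, G.Adj u y → G.Adj w y from
          fun u hu w hw h y hy => ⟨H u hu w hw h y hy, H w hw u hu h.symm y hy⟩
        rintro u ⟨hu, hux⟩ w ⟨hw, hwx⟩ h y hy ha
        have hyQ : y ∈ Q := by
          rcases hy with rfl | hy
          · exact hx
          · exact hy.1
        have hyx : t x ≤ t y := by
          rcases hy with rfl | hy
          · exact le_rfl
          · exact hy.2.le
        have hrx := hr x hx hxz
        by_cases hyz : y = z
        · have huz : u ≠ z := fun huz => ha.ne (huz.trans hyz.symm)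
          have hwz : w ≠ z := by
            rintro rfl
            rw [hyz] at hyx
            exact hwx.not_ge hyx
          simp only [huz, hwz, if_false] at h
          rw [hyz] at ha hyx ⊢
          rw [hz u hu huz] at ha
          rw [hz w hw hwz]
          rw [hlt1 w hw x hx hwz hxz] at hwx
          have := hlt3 x hx hxz
          omega
        · have hy' := hlt1 y hyQ x hx hyz hxz
          have hry := hr y hyQ hyz
          have hyn : ¬ t y < t x := hyx.not_gt
          by_cases huz : u = z
          · rw [huz] at hux
            rw [hlt3 x hx hxz] at hux
            rw [huz, G.adj_comm, hz y hyQ hyz] at ha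
            omega
          · have hru := hr u hu huz
            rw [hsame u hu y hyQ huz hyz] at ha
            rw [hlt1 u hu x hx huz hxz] at hux
            by_cases hwz : w = z
            · rw [hwz] at hwx
              rw [hlt3 x hx hxz] at hwx
              simp only [huz, hwz, if_false, if_true] at h
              unfold ColAdj at ha
              omega
            · have hrw := hr w hw hwz
              simp only [huz, hwz, if_false] at h
              rw [hsame w hw y hyQ hwz hyz]
              rw [hlt1 w hw x hx hwz hxz] at hwx
              unfold ColAdj at *
              omega

/-! ### Path layouts of `Z_k` and the upper bound -/

theorem colAdj_iff {k p q : ℕ} : ColAdj (p / (k + 1)) (p % (k + 1) + 1) (q / (k + 1))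
    (q % (k + 1) + 1) ↔ p ≠ q ∧ p ≤ q + k ∧ q ≤ p + k := by
  have h1 := Nat.div_add_mod p (k + 1)
  have h2 := Nat.div_add_mod q (k + 1)
  have h3 := Nat.mod_lt p k.succ_pos
  have h4 := Nat.mod_lt q k.succ_pos
  generalize p / (k + 1) = c at *
  generalize q / (k + 1) = d at *
  generalize p % (k + 1) = r at *
  generalize q % (k + 1) = s at *
  subst h1 h2
  unfold ColAdj
  rcases lt_trichotomy c d with h | rfl | h
  · obtain ⟨e, rfl⟩ := Nat.exists_eq_add_of_lt h
    rcases e with _ | e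
    · have : (k + 1) * (c + 0 + 1) = (k + 1) * c + (k + 1) := by ring
      omega
    · have : (k + 1) * (c + (e + 1) + 1) = (k + 1) * c + (k + 1) * e + 2 * (k + 1) := by ring
      have := Nat.zero_le ((k + 1) * e)
      omega
  · omega
  · obtain ⟨e, rfl⟩ := Nat.exists_eq_add_of_lt h
    rcases e with _ | e
    · have : (k + 1) * (d + 0 + 1) = (k + 1) * d + (k + 1) := by ring
      omega
    · have : (k + 1) * (d + (e + 1) + 1) = (k + 1) * d + (k + 1) * e + 2 * (k + 1) := by ring
      have := Nat.zero_le ((k + 1) * e)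
      omega

theorem div_mod_inj {n p q : ℕ} (h1 : p / n = q / n) (h2 : p % n = q % n) : p = q := by
  rw [← Nat.div_add_mod p n, h1, h2, Nat.div_add_mod]

/-- `pos` gives the vertices of `G` the positions of a `k`-path layout of `Z_k`. -/
structure IsPathLayout {V : Type*} (G : SimpleGraph V) (k : ℕ) (pos : V → ℕ) : Prop where
  inj : Function.Injective pos
  le : ∀ u, pos u ≤ k * (k + 1) + 1
  surj : ∀ p ≤ k * (k + 1) + 1, ∃ u, pos u = p
  adj : ∀ u w, G.Adj u w ↔ pos u ≠ pos w ∧ pos u ≤ pos w + k ∧ pos w ≤ pos u + k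

namespace IsPathLayout

variable {V : Type*} {G : SimpleGraph V} {k : ℕ} {pos : V → ℕ}

theorem finite (h : IsPathLayout G k pos) : Finite V :=
  Finite.of_injective (fun u => (⟨pos u, Nat.lt_succ_of_le (h.le u)⟩ : Fin (k * (k + 1) + 2)))
    fun u w huw => h.inj (by simpa using huw)

/-- In column 0 the row is the distance to `x`, so adjacency across `x` means that two such rows add
up to at most `k`. By `h1` the right side has at most `k` columns; by `h2` the left side has at most
`k - 1`, unless it is a single vertex. -/
theorem exists_builds_of_inner (h : IsPathLayout G k pos) {x : V} (h1 : 1 ≤ pos x)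
    (h2 : 2 * pos x ≤ k * (k + 1) + 1) :
    ∃ (l : V → Fin (k + 1)) (e : CliqueExpr V (k + 1)), Builds G {x}ᶜ l e := by
  have := h.finite
  have hk : 1 ≤ k := by
    rcases k with _ | k
    · omega
    · omega
  let p : V → ℕ := fun u => if pos x < pos u then pos u - pos x - 1 else pos x - pos u - 1
  have hne : ∀ u ∈ ({x}ᶜ : Set V), pos u ≠ pos x := fun u hu hp => hu (h.inj hp)
  refine exists_builds_of_columns G {x}ᶜ (Set.toFinite _) ?_ (fun u => decide (pos x < pos u))
    (fun u => p u / (k + 1)) (fun u => p u % (k + 1) + 1) ?_ ?_ ?_ ?_ ?_ ?_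
  · obtain ⟨u, hu⟩ := h.surj 0 (Nat.zero_le _)
    refine ⟨u, fun hux => ?_⟩
    rw [Set.mem_singleton_iff] at hux
    rw [hux] at hu
    omega
  · intro u hu w hw hR hc hr
    have hp := div_mod_inj hc (by omega)
    have h3 := hne u hu
    have h4 := hne w hw
    apply h.inj
    simp only [p] at hp
    simp only [decide_eq_decide] at hR
    split_ifs at hp <;> omega
  · intro u hu
    have := Nat.mod_lt (p u) (show 0 < k + 1 by omega)
    omega
  · intro u hu
    have h3 := hne u hu
    have h4 := h.le u
    rw [Nat.div_lt_iff_lt_mul (by omega)]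
    simp only [p]
    split_ifs <;> omega
  · intro u hu w hw hRu hRw huw
    simp only [decide_eq_false_iff_not, not_lt] at hRu hRw
    have h3 := hne u hu
    have h4 := hne w hw
    have h5 : pos u ≠ pos w := fun h5 => huw (h.inj h5)
    have h6 : p u = pos x - pos u - 1 := if_neg (by omega)
    obtain ⟨j, rfl⟩ : ∃ j, k = j + 2 := by
      rcases k with _ | _ | j
      · omega
      · omega
      · exact ⟨j, rfl⟩
    have : p u / (j + 2 + 1) < j + 1 := by
      rw [Nat.div_lt_iff_lt_mul (by omega), h6]
      by_contra hcon
      have h7 : (j + 1) * (j + 2 + 1) + 1 ≤ pos x := by omega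
      nlinarith
    omega
  · intro u hu w hw hR
    rw [h.adj, colAdj_iff]
    simp only [decide_eq_decide] at hR
    have h3 := hne u hu
    have h4 := hne w hw
    simp only [p]
    split_ifs <;> omega
  · intro u hu w hw hRu hRw
    simp only [decide_eq_false_iff_not, not_lt, decide_eq_true_eq] at hRu hRw
    have h3 := hne u hu
    have h4 := hne w hw
    have h5 : p u = pos u - pos x - 1 := if_pos hRu
    have h6 : p w = pos x - pos w - 1 := if_neg (by omega)
    rw [h.adj]
    simp only [Nat.div_eq_zero_iff]
    constructor
    · intro ha
      have h7 : p u < k + 1 := by omega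
      have h8 : p w < k + 1 := by omega
      rw [Nat.mod_eq_of_lt h7, Nat.mod_eq_of_lt h8]
      omega
    · rintro ⟨h7, h8, h9⟩
      rw [Nat.mod_eq_of_lt (by omega), Nat.mod_eq_of_lt (by omega)] at h9
      omega

/-- The second vertex of the path is the extra vertex `z`; the other `k (k + 1)` vertices fill `k`
columns exactly. -/
theorem exists_builds_of_end (h : IsPathLayout G k pos) {x : V} (hx : pos x = 0) :
    ∃ (l : V → Fin (k + 1)) (e : CliqueExpr V (k + 1)), Builds G {x}ᶜ l e := by
  have := h.finite
  obtain ⟨z, hz⟩ := h.surj 1 (by omega)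
  let p : V → ℕ := fun u => pos u - 2
  have hne : ∀ u ∈ ({x}ᶜ : Set V), u ≠ z → 2 ≤ pos u := by
    intro u hu huz
    have h1 : pos u ≠ 0 := fun hp => hu (h.inj (hp.trans hx.symm))
    have h2 : pos u ≠ 1 := fun hp => huz (h.inj (hp.trans hz.symm))
    omega
  have hc : ∀ u ∈ ({x}ᶜ : Set V), u ≠ z → p u / (k + 1) < k := by
    intro u hu huz
    have h3 := hne u hu huz
    have h4 := h.le u
    rw [Nat.div_lt_iff_lt_mul (by omega)]
    simp only [p]
    omega
  have hex : ∀ c < k, ∃ w ∈ ({x}ᶜ : Set V), w ≠ z ∧ p w / (k + 1) = c ∧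
      p w % (k + 1) + 1 = k + 1 := by
    intro c hc
    have : (c + 1) * (k + 1) ≤ k * (k + 1) := Nat.mul_le_mul_right _ hc
    obtain ⟨w, hw⟩ := h.surj ((k + 1) * c + k + 2) (by linarith)
    have hpw : p w = k + (k + 1) * c := by
      simp only [p]
      omega
    refine ⟨w, fun hwx => ?_, fun hwz => ?_, ?_, ?_⟩
    · rw [Set.mem_singleton_iff] at hwx
      rw [hwx] at hw
      omega
    · rw [hwz] at hw
      omega
    · rw [hpw, Nat.add_mul_div_left _ _ k.succ_pos, Nat.div_eq_of_lt k.lt_succ_self, zero_add]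
    · rw [hpw, Nat.add_mul_mod_self_left, Nat.mod_eq_of_lt k.lt_succ_self]
  refine exists_builds_of_rows G {x}ᶜ (Set.toFinite _) z ?_
    (fun u => p u / (k + 1)) (fun u => p u % (k + 1) + 1) ?_ ?_ hc ?_ ?_ ?_ ?_
  · intro hzx
    rw [Set.mem_singleton_iff] at hzx
    rw [hzx] at hz
    omega
  · intro u hu w hw huz hwz hc hr
    have hp := div_mod_inj hc (by omega)
    have h3 := hne u hu huz
    have h4 := hne w hw hwz
    apply h.inj
    simp only [p] at hp
    omega
  · intro u hu huz
    have := Nat.mod_lt (p u) (show 0 < k + 1 by omega)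
    omega
  · intro u hu w hw huz hwz
    rw [h.adj, colAdj_iff]
    have h3 := hne u hu huz
    have h4 := hne w hw hwz
    simp only [p]
    omega
  · intro u hu huz
    have h3 := hne u hu huz
    rw [h.adj, hz]
    simp only [Nat.div_eq_zero_iff]
    constructor
    · intro ha
      have h7 : p u < k + 1 := by simp only [p]; omega
      rw [Nat.mod_eq_of_lt h7]
      simp only [p] at h7 ⊢
      omega
    · rintro ⟨h7, h9⟩
      rw [Nat.mod_eq_of_lt (by omega)] at h9
      simp only [p] at h9
      omega
  · exact fun u hu huz => hex _ (hc u hu huz)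
  · exact fun u hu huz => hex 0 (Nat.zero_lt_of_lt (hc u hu huz))

theorem rev (h : IsPathLayout G k pos) : IsPathLayout G k fun u => k * (k + 1) + 1 - pos u where
  inj u w huw := by
    have h1 := h.le u
    have h2 := h.le w
    apply h.inj
    dsimp only at huw
    omega
  le u := Nat.sub_le _ _
  surj p hp := by
    obtain ⟨u, hu⟩ := h.surj (k * (k + 1) + 1 - p) (Nat.sub_le _ _)
    exact ⟨u, by omega⟩
  adj u w := by
    have h1 := h.le u
    have h2 := h.le w
    rw [h.adj]
    omega

theorem exists_builds (h : IsPathLayout G k pos) (x : V) :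
    ∃ (l : V → Fin (k + 1)) (e : CliqueExpr V (k + 1)), Builds G {x}ᶜ l e := by
  have key : ∀ {pos : V → ℕ}, IsPathLayout G k pos → 2 * pos x ≤ k * (k + 1) + 1 →
      ∃ (l : V → Fin (k + 1)) (e : CliqueExpr V (k + 1)), Builds G {x}ᶜ l e := by
    intro pos h h2
    rcases Nat.eq_zero_or_pos (pos x) with h0 | h1
    · exact h.exists_builds_of_end h0
    · exact h.exists_builds_of_inner h1 h2
  by_cases h2 : 2 * pos x ≤ k * (k + 1) + 1
  · exact key h h2
  · exact key h.rev (by omega)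

end IsPathLayout

theorem pathPower_adj {k n : ℕ} {u w : Fin n} : (pathPower k n).Adj u w ↔
    (u : ℕ) ≠ w ∧ (u : ℕ) ≤ w + k ∧ (w : ℕ) ≤ u + k := by
  simp only [pathPower, SimpleGraph.fromRel_adj, ne_eq, Fin.ext_iff, Fin.lt_def]
  omega

theorem isPathLayout_graphZ (k : ℕ) :
    IsPathLayout (graphZ k) k (fun u : Fin (k * (k + 1) + 2) => (u : ℕ)) where
  inj := Fin.val_injective
  le u := Nat.lt_succ_iff.1 u.2
  surj p hp := ⟨⟨p, Nat.lt_succ_of_le hp⟩, rfl⟩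
  adj _ _ := pathPower_adj

theorem linearCliqueWidth_induce_graphZ_le {k : ℕ} {S : Set (Fin (k * (k + 1) + 2))}
    (hS : S ≠ Set.univ) : linearCliqueWidth ((graphZ k).induce S) ≤ (k + 1 : ℕ) := by
  obtain ⟨x, hx⟩ := (Set.ne_univ_iff_exists_notMem S).1 hS
  obtain ⟨l, e, h⟩ := (isPathLayout_graphZ k).exists_builds x
  exact h.linearCliqueWidth_induce_le fun u hu hux => hx (hux ▸ hu)

theorem cliqueWidth_le_linearCliqueWidth {V : Type*} (G : SimpleGraph V) :
    cliqueWidth G ≤ linearCliqueWidth G := by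
  refine sInf_le_sInf ?_
  rintro m ⟨k, hm, h⟩
  exact ⟨k, hm, h.imp id fun ⟨e, he⟩ => ⟨e, he.2⟩⟩

/-! ### A counting lemma -/

/-- Injective partial maps from `Y` to `L` and to `R` whose domains cover `Y` are surjective and
have disjoint domains if `Y` has at least as many elements as `L` and `R` together. -/
theorem Finset.exists_of_card_add_card_le {α : Type*} {Y L R : Finset α}
    {DL DR : α → Prop} {f g : α → α} (hL : ∀ y ∈ Y, DL y → g y ∈ L) (hR : ∀ y ∈ Y, DR y → f y ∈ R)
    (hL' : ∀ y ∈ Y, ∀ y' ∈ Y, DL y → DL y' → g y = g y' → y = y')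
    (hR' : ∀ y ∈ Y, ∀ y' ∈ Y, DR y → DR y' → f y = f y' → y = y')
    (hD : ∀ y ∈ Y, DL y ∨ DR y) (hcard : L.card + R.card ≤ Y.card) :
    (∀ l ∈ L, ∃ y ∈ Y, DL y ∧ g y = l) ∧ (∀ r ∈ R, ∃ y ∈ Y, DR y ∧ f y = r) ∧
      ∀ y ∈ Y, DL y → ¬ DR y := by
  classical
  have h1 : ((Y.filter DL).image g) ⊆ L := by
    intro l hl
    obtain ⟨y, hy, rfl⟩ := Finset.mem_image.1 hl
    rw [Finset.mem_filter] at hy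
    exact hL y hy.1 hy.2
  have h2 : ((Y.filter DR).image f) ⊆ R := by
    intro l hl
    obtain ⟨y, hy, rfl⟩ := Finset.mem_image.1 hl
    rw [Finset.mem_filter] at hy
    exact hR y hy.1 hy.2
  have c1 : ((Y.filter DL).image g).card = (Y.filter DL).card :=
    Finset.card_image_of_injOn fun y hy y' hy' h => by
      simp only [Finset.coe_filter, Set.mem_ofPred_eq] at hy hy'
      exact hL' y hy.1 y' hy'.1 hy.2 hy'.2 h
  have c2 : ((Y.filter DR).image f).card = (Y.filter DR).card :=
    Finset.card_image_of_injOn fun y hy y' hy' h => by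
      simp only [Finset.coe_filter, Set.mem_ofPred_eq] at hy hy'
      exact hR' y hy.1 y' hy'.1 hy.2 hy'.2 h
  have c3 := Finset.card_le_card h1
  have c4 := Finset.card_le_card h2
  have c5 := Finset.card_union_add_card_inter (Y.filter DL) (Y.filter DR)
  have c6 : Y.filter DL ∪ Y.filter DR = Y := by
    ext y
    simp only [Finset.mem_union, Finset.mem_filter]
    exact ⟨fun h => h.elim And.left And.left, fun h => (hD y h).imp (And.intro h) (And.intro h)⟩
  rw [c6] at c5
  have e1 := Finset.eq_of_subset_of_card_le h1 (by omega)
  have e2 := Finset.eq_of_subset_of_card_le h2 (by omega)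
  have e3 : Y.filter DL ∩ Y.filter DR = ∅ := Finset.card_eq_zero.1 (by omega)
  refine ⟨fun l hl => ?_, fun r hr => ?_, fun y hy hyl hyr => ?_⟩
  · rw [← e1] at hl
    obtain ⟨y, hy, rfl⟩ := Finset.mem_image.1 hl
    rw [Finset.mem_filter] at hy
    exact ⟨y, hy.1, hy.2, rfl⟩
  · rw [← e2] at hr
    obtain ⟨y, hy, rfl⟩ := Finset.mem_image.1 hr
    rw [Finset.mem_filter] at hy
    exact ⟨y, hy.1, hy.2, rfl⟩
  · have : y ∈ Y.filter DL ∩ Y.filter DR := by simp [hy, hyl, hyr]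
    rw [e3] at this
    simp at this

/-! ### Coloured subsets of a path power with no long monochromatic interval -/

/-- `x` and `y` have the same colour, and the same neighbours outside their colour class, in the
path power with vertices `1, …, n`. The colour `0` stands for the absence of a colour. -/
def Twin (k n : ℤ) (κ : ℤ → ℕ) (x y : ℤ) : Prop :=
  κ x ≠ 0 ∧ κ y = κ x ∧ ∀ z, 1 ≤ z → z ≤ n → κ z ≠ κ x → (|z - x| ≤ k ↔ |z - y| ≤ k)

/-- A colouring of some of the vertices `1, …, n` of a path power without monochromatic interval of
`k + 1` vertices, without uncoloured interval of `k` inner vertices, and with at most `k + 1`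
classes of twins. -/
structure Coloring (k n : ℤ) (κ : ℤ → ℕ) : Prop where
  two_le : 2 ≤ k
  n_eq : n = k * (k + 1) + 2
  range : ∀ x, κ x ≠ 0 → 1 ≤ x ∧ x ≤ n
  not_mono : ∀ j, κ j ≠ 0 → ∃ x, j ≤ x ∧ x ≤ j + k ∧ κ x ≠ κ j
  hit : ∀ i, 2 ≤ i → i + k ≤ n → ∃ x, i ≤ x ∧ x < i + k ∧ κ x ≠ 0
  few : ∀ S : Finset ℤ, (∀ x ∈ S, κ x ≠ 0) → (∀ x ∈ S, ∀ y ∈ S, x < y → ¬ Twin k n κ x y) →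
    (S.card : ℤ) ≤ k + 1

namespace Twin

variable {k n : ℤ} {κ : ℤ → ℕ} {x y z : ℤ}

theorem symm (h : Twin k n κ x y) : Twin k n κ y x :=
  ⟨by rw [h.2.1]; exact h.1, h.2.1.symm, fun z h1 h2 h3 => (h.2.2 z h1 h2 (by rwa [← h.2.1])).symm⟩

theorem trans (h : Twin k n κ x y) (h' : Twin k n κ y z) : Twin k n κ x z :=
  ⟨h.1, h'.2.1.trans h.2.1, fun w h1 h2 h3 =>
    (h.2.2 w h1 h2 h3).trans (h'.2.2 w h1 h2 (by rwa [h.2.1]))⟩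

theorem reflect (h : Twin k n κ x y) :
    Twin k n (fun z => κ (n + 1 - z)) (n + 1 - x) (n + 1 - y) := by
  refine ⟨by simpa using h.1, by simpa using h.2.1, fun z h1 h2 h3 => ?_⟩
  have h3' : κ (n + 1 - z) ≠ κ x := by simpa using h3
  have := h.2.2 (n + 1 - z) (by omega) (by omega) h3'
  rw [show z - (n + 1 - x) = -((n + 1 - z) - x) by ring,
    show z - (n + 1 - y) = -((n + 1 - z) - y) by ring, abs_neg, abs_neg]
  exact this

end Twin

namespace Coloring

variable {k n : ℤ} {κ : ℤ → ℕ} {x y z : ℤ}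

theorem reflect (h : Coloring k n κ) : Coloring k n fun z => κ (n + 1 - z) where
  two_le := h.two_le
  n_eq := h.n_eq
  range x hx := by
    have := h.range _ hx
    omega
  not_mono j hj := by
    by_contra! hcon
    have h0 : κ (n + 1 - j - k) = κ (n + 1 - j) := by
      have := hcon (j + k) (by linarith [h.two_le]) le_rfl
      rwa [show n + 1 - (j + k) = n + 1 - j - k by ring] at this
    obtain ⟨x, h1, h2, h3⟩ := h.not_mono (n + 1 - j - k) (by rwa [h0])
    rw [h0] at h3
    apply h3
    have := hcon (n + 1 - x) (by omega) (by omega)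
    simpa using this
  hit i h1 h2 := by
    obtain ⟨x, h3, h4, h5⟩ := h.hit (n + 2 - i - k) (by omega) (by omega)
    exact ⟨n + 1 - x, by omega, by omega, by simpa using h5⟩
  few S h1 h2 := by
    classical
    have h3 := h.few (S.image fun z => n + 1 - z) (by
      simp only [Finset.mem_image, forall_exists_index, and_imp, forall_apply_eq_imp_iff₂]
      exact h1) (by
      simp only [Finset.mem_image, forall_exists_index, and_imp, forall_apply_eq_imp_iff₂]
      intro a ha b hb hab ht
      refine h2 b hb a ha (by omega) ?_
      have := ht.symm.reflect
      simpa using this)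
    rwa [Finset.card_image_of_injective] at h3
    intro a b hab
    simpa using hab

theorem four_mul_le (h : Coloring k n κ) : 4 * k ≤ n := by
  have := h.two_le
  rw [h.n_eq]
  nlinarith

theorem three_mul_lt (h : Coloring k n κ) : 3 * k + 1 < n := by
  have := h.two_le
  rw [h.n_eq]
  nlinarith

/-- Only vertices of their own colour can tell twins apart, and `z` is near `y` but not near `x`. -/
theorem color_eq_of_twin (ht : Twin k n κ x y) (h1 : 1 ≤ z) (hn : z ≤ n) (h2 : y ≤ z + k)
    (h3 : z ≤ y + k) (h4 : z + k < x ∨ x + k < z) : κ z = κ x := by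
  by_contra hz
  have := (ht.2.2 z h1 hn hz).2 (abs_le.2 ⟨by omega, by omega⟩)
  rw [abs_le] at this
  omega

/-- Neighbours of one twin only have its colour. If the twins were `k` or more apart, the `k`
vertices left of `x` and those right of `y` would give monochromatic intervals, unless `x` and `y`
are close to the two ends; but then `x, …, x + k` is monochromatic. -/
theorem lt_add_of_twin (h : Coloring k n κ) (ht : Twin k n κ x y) (hxy : x < y) : y < x + k := by
  by_contra! hcon
  have hx := h.range x ht.1
  have hy := h.range y ht.symm.1
  have hk := h.two_le
  have hn := h.four_mul_le
  have h1 : x ≤ k := by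
    by_contra! h1
    have : ∀ z, x - k ≤ z → z < x → κ z = κ x := fun z hz hz' => by
      rw [← ht.2.1]
      exact color_eq_of_twin ht.symm (by omega) (by omega) (by omega) (by omega) (by omega)
    have h0 := this (x - k) le_rfl (by omega)
    obtain ⟨z, hz1, hz2, hz3⟩ := h.not_mono (x - k) (by rw [h0]; exact ht.1)
    rw [h0] at hz3
    rcases (show z ≤ x by omega).lt_or_eq with hz | rfl
    · exact hz3 (this z hz1 hz)
    · exact hz3 rfl
  have h2 : n < y + k := by
    by_contra! h2
    have : ∀ z, y < z → z ≤ y + k → κ z = κ y := fun z hz hz' => by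
      rw [ht.2.1]
      exact color_eq_of_twin ht (by omega) (by omega) (by omega) (by omega) (by omega)
    obtain ⟨z, hz1, hz2, hz3⟩ := h.not_mono y ht.symm.1
    rcases hz1.lt_or_eq with hz | rfl
    · exact hz3 (this z hz hz2)
    · exact hz3 rfl
  obtain ⟨z, hz1, hz2, hz3⟩ := h.not_mono x ht.1
  rcases hz1.lt_or_eq with hz | rfl
  · refine hz3 ?_
    rw [← ht.2.1]
    exact color_eq_of_twin ht.symm (by omega) (by omega) (by omega) (by omega) (by omega)
  · exact hz3 rfl

/-- The vertices `x + k + 1, …, y + k` are adjacent to `y` and not to `x`. This carries the colour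
of a pair of twins to the right in steps of size `k`. -/
theorem color_right (h : Coloring k n κ) (ht : Twin k n κ x y) (hxy : x < y) (h1 : x + k < z)
    (h2 : z ≤ y + k) (hn : z ≤ n) : κ z = κ x := by
  have hx := h.range x ht.1
  have := h.lt_add_of_twin ht hxy
  have := h.two_le
  exact color_eq_of_twin ht (by omega) hn (by omega) h2 (Or.inr h1)

theorem color_left (h : Coloring k n κ) (ht : Twin k n κ x y) (hxy : x < y) (h1 : x ≤ z + k)
    (h2 : z + k < y) (hz : 1 ≤ z) : κ z = κ x := by
  have hy := h.range y ht.symm.1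
  have := h.lt_add_of_twin ht hxy
  have := h.two_le
  rw [← ht.2.1]
  exact color_eq_of_twin ht.symm hz (by omega) h1 (by omega) (Or.inl h2)

theorem twin_of_lt_of_lt (h : Coloring k n κ) (ht : Twin k n κ x y) (hxz : x < z) (hzy : z < y)
    (hz : κ z = κ x) : Twin k n κ x z := by
  refine ⟨ht.1, hz, fun w h1 h2 h3 => ?_⟩
  have := ht.2.2 w h1 h2 h3
  have := h.lt_add_of_twin ht (hxz.trans hzy)
  simp only [abs_le] at *
  omega

theorem not_twin_of_le (h : Coloring k n κ) (hxy : x + k ≤ y) : ¬ Twin k n κ x y := fun ht => by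
  have := h.two_le
  have := h.lt_add_of_twin ht (by omega)
  omega

/-- Two elements outside a colour class can be replaced by two that are not twins. -/
theorem exists_not_twin (h : Coloring k n κ) (hxy : x < y) (hx0 : κ x ≠ 0) (hy0 : κ y ≠ 0) {b : ℕ}
    (hx : κ x ≠ b) (hy : κ y ≠ b) :
    ∃ u v, u < v ∧ κ u ≠ 0 ∧ κ v ≠ 0 ∧ κ u ≠ b ∧ κ v ≠ b ∧ ¬ Twin k n κ u v := by
  by_cases hc : κ y = κ x
  -- Take the two extreme vertices of the colour class: if they were twins, `color_right` or
  -- `color_left` would give a vertex of the class beyond them.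
  · obtain ⟨u, hu, hu'⟩ := Int.exists_least_of_bdd (P := fun z => κ z = κ x)
      ⟨1, fun z hz => (h.range z (by rwa [hz])).1⟩ ⟨x, rfl⟩
    obtain ⟨v, hv, hv'⟩ := Int.exists_greatest_of_bdd (P := fun z => κ z = κ x)
      ⟨n, fun z hz => (h.range z (by rwa [hz])).2⟩ ⟨x, rfl⟩
    have huv : u < v := (hu' x rfl).trans_lt (hxy.trans_le (hv' y hc))
    refine ⟨u, v, huv, by rwa [hu], by rwa [hv], by rwa [hu], by rwa [hv], fun ht => ?_⟩
    have h1 := h.lt_add_of_twin ht huv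
    have h2 := h.three_mul_lt
    have h3 : n < u + k + 1 := by
      by_contra! h3
      have := hv' _ ((h.color_right ht huv (z := u + k + 1) (by omega) (by omega) h3).trans hu)
      omega
    have h4 : v - k - 1 < 1 := by
      by_contra! h4
      have := hu' _ ((h.color_left ht huv (z := v - k - 1) (by omega) (by omega) h4).trans hu)
      omega
    omega
  · exact ⟨x, y, hxy, hx0, hy0, hx, hy, fun ht => hc ht.2.1⟩

theorem exists_color_ne (h : Coloring k n κ) {j : ℤ}
    (hj : ∀ z, j ≤ z → z ≤ j + k → κ z ≠ 0) (b : ℕ) :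
    ∃ z, j ≤ z ∧ z ≤ j + k ∧ κ z ≠ 0 ∧ κ z ≠ b := by
  have hk := h.two_le
  by_cases hb : κ j = b
  · obtain ⟨z, h1, h2, h3⟩ := h.not_mono j (hj j le_rfl (by omega))
    exact ⟨z, h1, h2, hj z h1 h2, by rwa [← hb]⟩
  · exact ⟨j, le_rfl, by omega, hj j le_rfl (by omega), hb⟩

/-- A monochromatic sequence with steps of size at least `k` consists of vertices that are pairwise
no twins. -/
theorem length_add_card_le (h : Coloring k n κ) {b : ℕ} (hb : b ≠ 0) {g : ℕ → ℤ} {N : ℕ}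
    (hg : ∀ i ≤ N, κ (g i) = b) (hg' : ∀ i < N, g i + k ≤ g (i + 1)) (T : Finset ℤ)
    (hT : ∀ x ∈ T, κ x ≠ 0 ∧ κ x ≠ b) (hT' : ∀ x ∈ T, ∀ y ∈ T, x < y → ¬ Twin k n κ x y) :
    (N : ℤ) + T.card ≤ k := by
  have hk := h.two_le
  have hmono : ∀ i j, i < j → j ≤ N → g i + k ≤ g j := by
    intro i j hij hj
    induction j, hij using Nat.le_induction with
    | base => exact hg' i hj
    | succ m hm ih =>
      have := ih (by omega)
      have := hg' m (by omega)
      omega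
  have hinj : Set.InjOn g (Finset.range (N + 1) : Set ℕ) := by
    intro i hi j hj hij
    simp only [Finset.coe_range, Set.mem_Iio] at hi hj
    rcases lt_trichotomy i j with h' | h' | h'
    · have := hmono i j h' (by omega)
      omega
    · exact h'
    · have := hmono j i h' (by omega)
      omega
  have hcol : ∀ x ∈ (Finset.range (N + 1)).image g, κ x = b := by
    intro x hx
    obtain ⟨i, hi, rfl⟩ := Finset.mem_image.1 hx
    exact hg i (by simpa [Nat.lt_succ_iff] using hi)
  have hd : Disjoint ((Finset.range (N + 1)).image g) T :=
    Finset.disjoint_left.2 fun x hx hxT => (hT x hxT).2 (hcol x hx)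
  have := h.few ((Finset.range (N + 1)).image g ∪ T) (fun x hx => by
    rcases Finset.mem_union.1 hx with hx | hx
    · rwa [hcol x hx]
    · exact (hT x hx).1) (by
    intro x hx y hy hxy ht
    rcases Finset.mem_union.1 hx with hx | hx <;> rcases Finset.mem_union.1 hy with hy | hy
    · obtain ⟨i, hi, rfl⟩ := Finset.mem_image.1 hx
      obtain ⟨j, hj, rfl⟩ := Finset.mem_image.1 hy
      rw [Finset.mem_range] at hi hj
      rcases lt_trichotomy i j with h' | rfl | h'
      · exact h.not_twin_of_le (hmono i j h' (by omega)) ht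
      · exact lt_irrefl _ hxy
      · have := hmono j i h' (by omega)
        omega
    · exact (hT y hy).2 (by rw [ht.2.1, hcol x hx])
    · exact (hT x hx).2 (by rw [← ht.2.1, hcol y hy])
    · exact hT' x hx y hy hxy ht)
  rw [Finset.card_union_of_disjoint hd, Finset.card_image_of_injOn hinj, Finset.card_range] at this
  push_cast at this
  linarith

/-! ### Chains of steps of size `k` -/

/-- The sequence of steps of size `k` to the right from the larger of two twins. -/
theorem exists_chain_right (h : Coloring k n κ) (hy : ∃ x < y, Twin k n κ x y) :
    ∃ I : ℕ, (∀ i : ℕ, i ≤ I → κ (y + i * k) = κ y) ∧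
      (n < y + I * k + k ∨ (0 < I ∧ ¬ ∃ x < y + I * k, Twin k n κ x (y + I * k))) := by
  have hk := h.two_le
  generalize hm : (n - y).toNat = m
  induction m using Nat.strong_induction_on generalizing y with
  | _ m ih =>
    obtain ⟨x, hxy, ht⟩ := hy
    have hyn := (h.range y ht.symm.1).2
    by_cases hs : n < y + k
    · exact ⟨0, fun i hi => by simp [Nat.le_zero.1 hi], Or.inl (by simpa using hs)⟩
    · have hc : κ (y + k) = κ y := by
        rw [h.color_right ht hxy (by omega) le_rfl (by omega), ht.2.1]
      by_cases hd : ∃ x < y + k, Twin k n κ x (y + k)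
      · obtain ⟨I, h1, h2⟩ := ih _ (by omega) hd rfl
        have e : ∀ i : ℕ, y + ((i + 1 : ℕ) : ℤ) * k = y + k + i * k := fun i => by push_cast; ring
        refine ⟨I + 1, fun i hi => ?_, ?_⟩
        · rcases i with _ | i
          · simp
          · rw [e, h1 i (by omega), hc]
        · rw [e]
          exact h2.imp id fun h2 => ⟨by omega, h2.2⟩
      · refine ⟨1, fun i hi => ?_, Or.inr ⟨one_pos, by simpa using hd⟩⟩
        interval_cases i
        · simp
        · simpa using hc

theorem exists_chain_left (h : Coloring k n κ) (hx : ∃ y > x, Twin k n κ x y) :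
    ∃ I : ℕ, (∀ i : ℕ, i ≤ I → κ (x - i * k) = κ x) ∧
      (x - I * k ≤ k ∨ (0 < I ∧ ¬ ∃ y > x - I * k, Twin k n κ (x - I * k) y)) := by
  obtain ⟨y, hxy, ht⟩ := hx
  obtain ⟨I, h1, h2⟩ := h.reflect.exists_chain_right (y := n + 1 - x)
    ⟨n + 1 - y, by omega, ht.symm.reflect⟩
  have e : ∀ i : ℕ, n + 1 - (n + 1 - x + i * k) = x - i * k := fun i => by ring
  refine ⟨I, fun i hi => ?_, h2.imp (fun h2 => by linarith) fun h2 => ⟨h2.1, ?_⟩⟩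
  · have := h1 i hi
    simp only [e] at this
    simpa using this
  · rintro ⟨z, hz, ht'⟩
    refine h2.2 ⟨n + 1 - z, by linarith, ?_⟩
    have := ht'.symm.reflect
    rwa [show n + 1 - (x - I * k) = n + 1 - x + I * k by ring] at this

theorem exists_chain (h : Coloring k n κ) (ht : Twin k n κ x y) (hxy : x < y) {I J : ℕ}
    (hI : ∀ i : ℕ, i ≤ I → κ (x - i * k) = κ x) (hJ : ∀ i : ℕ, i ≤ J → κ (y + i * k) = κ y) :
    ∃ g : ℕ → ℤ, (∀ i ≤ I + J, κ (g i) = κ x) ∧ ∀ i < I + J, g i + k ≤ g (i + 1) := by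
  have hk := h.two_le
  -- The sequence is `x - I k, …, x - k, y, y + k, …, y + J k`; `x` is left out because it is a twin
  -- of `y`.
  refine ⟨fun i => if i < I then x - ((I - i : ℕ) : ℤ) * k else y + ((i - I : ℕ) : ℤ) * k, ?_, ?_⟩
  · intro i hi
    dsimp only
    split_ifs with h1
    · exact hI _ (by omega)
    · rw [hJ _ (by omega), ht.2.1]
  · intro i hi
    dsimp only
    rcases lt_trichotomy (i + 1) I with h1 | h1 | h1
    · rw [if_pos (by omega), if_pos h1,
        show ((I - i : ℕ) : ℤ) = ((I - (i + 1) : ℕ) : ℤ) + 1 by omega]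
      linarith
    · rw [if_pos (by omega), if_neg (by omega), show I - i = 1 by omega,
        show i + 1 - I = 0 by omega]
      push_cast
      linarith
    · rw [if_neg (by omega), if_neg (by omega),
        show ((i + 1 - I : ℕ) : ℤ) = ((i - I : ℕ) : ℤ) + 1 by omega]
      linarith

/-- The extent of the chains on both sides of two twins that are next to each other in their
colour class within an interval of `k + 1` coloured vertices. -/
theorem span_of_chains (h : Coloring k n κ) (ht : Twin k n κ x y) (hxy : x < y) {I J : ℕ}
    (hI : ∀ i : ℕ, i ≤ I → κ (x - i * k) = κ x) (hJ : ∀ i : ℕ, i ≤ J → κ (y + i * k) = κ y)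
    {j : ℤ} (hj : ∀ z, j ≤ z → z ≤ j + k → κ z ≠ 0) (hx : j ≤ x) (hy : y ≤ j + k)
    (hnext : ∀ z, x < z → z < y → κ z ≠ κ x)
    (hspan : n - 2 * k ≤ y + J * k - (x - I * k)) :
    y + J * k - (x - I * k) = n - 2 * k ∧ y = x + 2 ∧ ∀ z, κ z ≠ 0 → κ z ≠ κ x → z = x + 1 := by
  have hk := h.two_le
  have hxy' := h.lt_add_of_twin ht hxy
  have hn := h.n_eq
  obtain ⟨g, hg, hg'⟩ := h.exists_chain ht hxy hI hJ
  -- The span is `(I + J) k + (y - x)` with `y - x < k`, while `n - 2 k = (k - 1) k + 2`.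
  have hIJ : k - 1 ≤ (I : ℤ) + J := by
    by_contra! hcon
    nlinarith
  -- The chain has at least `k` vertices that are pairwise no twins, which leaves at most one class
  -- for the other colours.
  have hone : ∀ u v, u < v → κ u ≠ 0 → κ v ≠ 0 → κ u ≠ κ x → κ v ≠ κ x → False := by
    intro u v huv hu hv hu' hv'
    obtain ⟨u, v, huv, hu, hv, hu', hv', huv'⟩ := h.exists_not_twin huv hu hv hu' hv'
    have := h.length_add_card_le ht.1 hg hg' {u, v} (by simp [*]) (by
      simp only [Finset.mem_insert, Finset.mem_singleton]
      rintro x (rfl | rfl) y (rfl | rfl) hxy ht'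
      · exact lt_irrefl _ hxy
      · exact huv' ht'
      · exact lt_asymm huv hxy
      · exact lt_irrefl _ hxy)
    rw [Finset.card_pair huv.ne] at this
    push_cast at this
    omega
  have hone' : ∀ u v, κ u ≠ 0 → κ v ≠ 0 → κ u ≠ κ x → κ v ≠ κ x → u = v := by
    intro u v hu hv hu' hv'
    rcases lt_trichotomy u v with huv | huv | huv
    · exact (hone u v huv hu hv hu' hv').elim
    · exact huv
    · exact (hone v u huv hv hu hv' hu').elim
  have hgap : y ≤ x + 2 := by
    by_contra! hcon
    have := hone' (x + 1) (x + 2) (hj _ (by omega) (by omega)) (hj _ (by omega) (by omega))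
      (hnext _ (by omega) (by omega)) (hnext _ (by omega) (by omega))
    omega
  obtain ⟨c, -, -, hc, hc'⟩ := h.exists_color_ne hj (κ x)
  have hIJ' : (I : ℤ) + J ≤ k - 1 := by
    have := h.length_add_card_le ht.1 hg hg' {c} (by simp [*]) (by simp)
    rw [Finset.card_singleton] at this
    push_cast at this
    omega
  have hIJ'' : (I : ℤ) + J = k - 1 := le_antisymm hIJ' hIJ
  have hmul : (I : ℤ) * k + J * k = (k - 1) * k := by rw [← hIJ'']; ring
  have hmul' : (k - 1) * k = n - 2 * k - 2 := by rw [hn]; ring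
  have hy2 : y = x + 2 := by linarith
  exact ⟨by linarith, hy2, fun z hz hz' => hone' z (x + 1) hz (hj _ (by omega) (by omega)) hz'
    (hnext _ (by omega) (by omega))⟩

/-- For a pair close to the left end the right chain alone is too long: it takes at least `k` steps
if `y ≤ k + 1`; otherwise at least `k - 1`, and `y - k - 1` can be put in front. A vertex of another
colour adds one more class. -/
theorem not_chain_right (h : Coloring k n κ) (ht : Twin k n κ x y) (hxy : x < y) {J : ℕ}
    (hJ : ∀ i : ℕ, i ≤ J → κ (y + i * k) = κ y) {j : ℤ}
    (hj : ∀ z, j ≤ z → z ≤ j + k → κ z ≠ 0) (hy : y ≤ 2 * k + 1) (hspan : n ≤ y + J * k + k) :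
    False := by
  have hk := h.two_le
  have hn := h.n_eq
  have hx1 := (h.range x ht.1).1
  have hxk := h.lt_add_of_twin ht hxy
  obtain ⟨c, -, -, hc, hc'⟩ := h.exists_color_ne hj (κ x)
  by_cases hyk : y ≤ k + 1
  · obtain ⟨g, hg, hg'⟩ := h.exists_chain (I := 0) ht hxy
      (fun i hi => by simp [Nat.le_zero.1 hi]) hJ
    have := h.length_add_card_le ht.1 hg hg' {c} (by simp [*]) (by simp)
    rw [Finset.card_singleton] at this
    push_cast at this
    nlinarith
  · have hc1 : κ (y - k - 1) = κ x := h.color_left ht hxy (by omega) (by omega) (by omega)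
    have := h.length_add_card_le (N := J + 1) ht.1
      (g := fun i => if i = 0 then y - k - 1 else y + ((i - 1 : ℕ) : ℤ) * k) (by
        intro i hi
        split_ifs with h0
        · exact hc1
        · rw [hJ _ (by omega), ht.2.1]) (by
        intro i hi
        rcases i with _ | i
        · simp
          omega
        · simp
          linarith) {c} (by simp [*]) (by simp)
    rw [Finset.card_singleton] at this
    push_cast at this
    nlinarith

theorem not_chain_left (h : Coloring k n κ) (ht : Twin k n κ x y) (hxy : x < y) {I : ℕ}
    (hI : ∀ i : ℕ, i ≤ I → κ (x - i * k) = κ x) {j : ℤ}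
    (hj : ∀ z, j ≤ z → z ≤ j + k → κ z ≠ 0) (hx : n ≤ x + 2 * k) (hspan : x - I * k ≤ k + 1) :
    False := by
  refine h.reflect.not_chain_right (J := I) ht.symm.reflect (by omega) (fun i hi => ?_)
    (j := n + 1 - j - k) (fun z h1 h2 => hj _ (by omega) (by omega)) (by omega) (by linarith)
  have := hI i hi
  rw [show n + 1 - (n + 1 - x + i * k) = x - i * k by ring, this]
  simp

/-- As there is no gap, some coloured vertex follows `x` within `k`. If the first one has an earlier
twin, this twin lies at or before `x`, so `x + k + 1` is coloured; its twin class starts beyond `x`,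
since twins are less than `k` apart. -/
theorem exists_start_gt (h : Coloring k n κ) (hxn : x + k < n) (hx1 : 1 ≤ x) :
    ∃ s, x < s ∧ κ s ≠ 0 ∧ ¬ ∃ w < s, Twin k n κ w s := by
  have hk := h.two_le
  obtain ⟨v, hv1, hv2, hv3⟩ := h.hit (x + 1) (by omega) (by omega)
  obtain ⟨u, ⟨hu1, hu2⟩, hu3⟩ := Int.exists_least_of_bdd (P := fun z => x < z ∧ κ z ≠ 0)
    ⟨x, fun z hz => hz.1.le⟩ ⟨v, by omega, hv3⟩
  have huv := hu3 v ⟨by omega, hv3⟩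
  by_cases hu : ∃ w < u, Twin k n κ w u
  · obtain ⟨p, hpu, ht⟩ := hu
    have hpx : p ≤ x := by
      by_contra! hpx
      have := hu3 p ⟨hpx, ht.1⟩
      omega
    have hc : κ (x + k + 1) = κ p := h.color_right ht hpu (by omega) (by omega) (by omega)
    obtain ⟨s, hs, hs'⟩ := Int.exists_least_of_bdd (P := fun z => Twin k n κ z (x + k + 1))
      ⟨1, fun z hz => (h.range z hz.1).1⟩
      ⟨x + k + 1, by rw [hc]; exact ht.1, rfl, fun _ _ _ _ => Iff.rfl⟩
    refine ⟨s, ?_, hs.1, ?_⟩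
    · by_contra! hsx
      exact h.not_twin_of_le (by omega) hs
    · rintro ⟨w, hw, hws⟩
      have := hs' w (hws.trans hs)
      omega
  · exact ⟨u, hu1, hu2, hu⟩

theorem exists_last_start (h : Coloring k n κ) (hx : κ x ≠ 0) :
    ∃ s, κ s ≠ 0 ∧ n ≤ s + k ∧ ¬ ∃ w < s, Twin k n κ w s := by
  have hk := h.two_le
  obtain ⟨m, hm, hm'⟩ := Int.exists_least_of_bdd (P := fun z => Twin k n κ z x)
    ⟨1, fun z hz => (h.range z hz.1).1⟩ ⟨x, hx, rfl, fun _ _ _ _ => Iff.rfl⟩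
  obtain ⟨s, ⟨hs, hs'⟩, hs''⟩ := Int.exists_greatest_of_bdd
    (P := fun z => κ z ≠ 0 ∧ ¬ ∃ w < z, Twin k n κ w z)
    ⟨n, fun z hz => (h.range z hz.1).2⟩ ⟨m, hm.1, by
      rintro ⟨w, hw, hwm⟩
      have := hm' w (hwm.trans hm)
      omega⟩
  refine ⟨s, hs, ?_, hs'⟩
  by_contra! hcon
  obtain ⟨t, ht, ht'⟩ := h.exists_start_gt hcon (h.range s hs).1
  have := hs'' t ht'
  omega

theorem exists_first_end (h : Coloring k n κ) (hx : κ x ≠ 0) :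
    ∃ s, κ s ≠ 0 ∧ s ≤ k + 1 ∧ ¬ ∃ w > s, Twin k n κ s w := by
  obtain ⟨s, h1, h2, h3⟩ := h.reflect.exists_last_start (x := n + 1 - x) (by simpa using hx)
  refine ⟨n + 1 - s, h1, by omega, ?_⟩
  rintro ⟨w, hw, ht⟩
  refine h3 ⟨n + 1 - w, by omega, ?_⟩
  simpa using ht.symm.reflect

theorem exists_prev (h : Coloring k n κ) {j : ℤ} (hy : ∃ x, j ≤ x ∧ x < y ∧ Twin k n κ x y) :
    ∃ x, j ≤ x ∧ x < y ∧ Twin k n κ x y ∧ ∀ z, x < z → z < y → κ z ≠ κ x := by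
  obtain ⟨x, ⟨h1, h2, h3⟩, h4⟩ := Int.exists_greatest_of_bdd
    (P := fun x => j ≤ x ∧ x < y ∧ Twin k n κ x y) ⟨y, fun z hz => hz.2.1.le⟩ hy
  refine ⟨x, h1, h2, h3, fun z hxz hzy hz => ?_⟩
  have := h4 z ⟨by omega, hzy, (h.twin_of_lt_of_lt h3 hxz hzy hz).symm.trans h3⟩
  omega

theorem eq_of_add_mul_eq {k a b j : ℤ} {I J : ℕ} (ha : j ≤ a) (ha' : a < j + k) (hb : j ≤ b)
    (hb' : b < j + k) (h : a + I * k = b + J * k) : a = b := by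
  rcases lt_trichotomy I J with hIJ | rfl | hIJ
  · have : (I : ℤ) + 1 ≤ J := by exact_mod_cast hIJ
    nlinarith
  · linarith
  · have : (J : ℤ) + 1 ≤ I := by exact_mod_cast hIJ
    nlinarith

/-- A `Coloring` has no interval of `k + 1` coloured vertices. -/
theorem exists_eq_zero (h : Coloring k n κ) (j : ℤ) : ∃ z, j ≤ z ∧ z ≤ j + k ∧ κ z = 0 := by
  classical
  by_contra! hj
  have hk := h.two_le
  have hn := h.three_mul_lt
  let W : Finset ℤ := Finset.Icc j (j + k)
  -- `C` has one vertex of each twin class that meets `W`; `R` and `L` have one vertex of each class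
  -- lying entirely to the right or to the left of `W`. Hence `|L| + |C| + |R| ≤ k + 1 = |Y| + |C|`.
  let Y := W.filter fun y => ∃ x, j ≤ x ∧ x < y ∧ Twin k n κ x y
  let C := W.filter fun y => ¬ ∃ x, j ≤ x ∧ x < y ∧ Twin k n κ x y
  let R := (Finset.Icc 1 n).filter fun y => j + k < y ∧ κ y ≠ 0 ∧ ¬ ∃ x < y, Twin k n κ x y
  let L := (Finset.Icc 1 n).filter fun y => y < j ∧ κ y ≠ 0 ∧ ¬ ∃ x > y, Twin k n κ y x
  have hmW : ∀ y, y ∈ W ↔ j ≤ y ∧ y ≤ j + k := fun y => by simp [W]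
  have hmY : ∀ y, y ∈ Y ↔ (j ≤ y ∧ y ≤ j + k) ∧ ∃ x, j ≤ x ∧ x < y ∧ Twin k n κ x y :=
    fun y => by rw [Finset.mem_filter, hmW]
  have hmC : ∀ y, y ∈ C ↔ (j ≤ y ∧ y ≤ j + k) ∧ ¬ ∃ x, j ≤ x ∧ x < y ∧ Twin k n κ x y :=
    fun y => by rw [Finset.mem_filter, hmW]
  have hmR : ∀ y, y ∈ R ↔ j + k < y ∧ κ y ≠ 0 ∧ ¬ ∃ x < y, Twin k n κ x y := fun y => by
    rw [Finset.mem_filter, Finset.mem_Icc, and_iff_right_iff_imp]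
    exact fun hy => h.range y hy.2.1
  have hmL : ∀ y, y ∈ L ↔ y < j ∧ κ y ≠ 0 ∧ ¬ ∃ x > y, Twin k n κ y x := fun y => by
    rw [Finset.mem_filter, Finset.mem_Icc, and_iff_right_iff_imp]
    exact fun hy => h.range y hy.2.1
  have hcard : L.card + R.card ≤ Y.card := by
    have h1 : Y.card + C.card = W.card := Finset.card_filter_add_card_filter_not _
    have h2 : (W.card : ℤ) = k + 1 := by
      simp only [W, Int.card_Icc]
      omega
    have hLC : Disjoint L C := by
      rw [Finset.disjoint_left]
      intro y hy hy'
      rw [hmL] at hy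
      rw [hmC] at hy'
      omega
    have hLCR : Disjoint (L ∪ C) R := by
      rw [Finset.disjoint_left]
      intro y hy hy'
      rw [hmR] at hy'
      rcases Finset.mem_union.1 hy with hy | hy
      · rw [hmL] at hy
        omega
      · rw [hmC] at hy
        omega
    have h3 := h.few (L ∪ C ∪ R) (fun y hy => by
      rcases Finset.mem_union.1 hy with hy | hy
      · rcases Finset.mem_union.1 hy with hy | hy
        · exact ((hmL y).1 hy).2.1
        · exact hj y ((hmC y).1 hy).1.1 ((hmC y).1 hy).1.2
      · exact ((hmR y).1 hy).2.1) (fun x hx y hy hxy ht => by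
      rcases Finset.mem_union.1 hy with hy | hy
      · rcases Finset.mem_union.1 hx with hx | hx
        · rcases Finset.mem_union.1 hx with hx | hx
          · exact ((hmL x).1 hx).2.2 ⟨y, hxy, ht⟩
          · rcases Finset.mem_union.1 hy with hy | hy
            · have h1 := ((hmL y).1 hy).1
              have h2 := ((hmC x).1 hx).1
              omega
            · exact ((hmC y).1 hy).2 ⟨x, ((hmC x).1 hx).1.1, hxy, ht⟩
        · have h1 := ((hmR x).1 hx).1
          rcases Finset.mem_union.1 hy with hy | hy
          · have h2 := ((hmL y).1 hy).1
            omega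
          · have h2 := ((hmC y).1 hy).1
            omega
      · exact ((hmR y).1 hy).2.2 ⟨x, hxy, ht⟩)
    rw [Finset.card_union_of_disjoint hLCR, Finset.card_union_of_disjoint hLC] at h3
    push_cast at h3
    omega
  have hex : ∀ y, ∃ (x : ℤ) (I J : ℕ), y ∈ Y → (j ≤ x ∧ x < y ∧ y ≤ j + k ∧ Twin k n κ x y ∧
      (∀ z, x < z → z < y → κ z ≠ κ x)) ∧
      (∀ i : ℕ, i ≤ I → κ (x - i * k) = κ x) ∧ (∀ i : ℕ, i ≤ J → κ (y + i * k) = κ y) ∧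
      (x - I * k ≤ k ∨ (0 < I ∧ ¬ ∃ y > x - I * k, Twin k n κ (x - I * k) y)) ∧
      (n < y + J * k + k ∨ (0 < J ∧ ¬ ∃ x < y + J * k, Twin k n κ x (y + J * k))) := by
    intro y
    by_cases hy : y ∈ Y
    · obtain ⟨⟨-, h1⟩, h2⟩ := (hmY y).1 hy
      obtain ⟨x, h3, h4, h5, h6⟩ := h.exists_prev h2
      obtain ⟨I, hI, hI'⟩ := h.exists_chain_left ⟨y, h4, h5⟩
      obtain ⟨J, hJ, hJ'⟩ := h.exists_chain_right ⟨x, h4, h5⟩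
      exact ⟨x, I, J, fun _ => ⟨⟨h3, h4, h1, h5, h6⟩, hI, hJ, hI', hJ'⟩⟩
    · exact ⟨0, 0, 0, fun h => (hy h).elim⟩
  choose p I J hd hI hJ hI' hJ' using hex
  -- A chain from `y` or its predecessor `p y` that stops before the end of the path stops in `R` or
  -- `L`. The starting points lie in `k` consecutive integers and the steps have size `k`, so
  -- different chains stop at different vertices.
  obtain ⟨r1, r2, r3⟩ : (∀ l ∈ L, ∃ y ∈ Y, k < p y - I y * k ∧ p y - I y * k = l) ∧
      (∀ r ∈ R, ∃ y ∈ Y, y + J y * k + k ≤ n ∧ y + J y * k = r) ∧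
      ∀ y ∈ Y, k < p y - I y * k → ¬ y + J y * k + k ≤ n := by
    refine Finset.exists_of_card_add_card_le (DL := fun y => k < p y - I y * k)
      (DR := fun y => y + J y * k + k ≤ n) (f := fun y => y + J y * k)
      (g := fun y => p y - I y * k) ?_ ?_ ?_ ?_ ?_ hcard
    · intro y hy hD
      obtain ⟨h1, h2, h3, h4, h5⟩ := hd y hy
      obtain ⟨h6, h7⟩ := (hI' y hy).resolve_left (by omega)
      have : (1 : ℤ) ≤ I y := by exact_mod_cast h6
      rw [hmL]
      refine ⟨by nlinarith, ?_, h7⟩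
      rw [hI y hy _ le_rfl]
      exact h4.1
    · intro y hy hD
      obtain ⟨h1, h2, h3, h4, h5⟩ := hd y hy
      obtain ⟨h6, h7⟩ := (hJ' y hy).resolve_left (by omega)
      have : (1 : ℤ) ≤ J y := by exact_mod_cast h6
      rw [hmR]
      refine ⟨by nlinarith, ?_, h7⟩
      rw [hJ y hy _ le_rfl, h4.2.1]
      exact h4.1
    · intro y hy y' hy' _ _ he
      obtain ⟨h1, h2, h3, h4, h5⟩ := hd y hy
      obtain ⟨h1', h2', h3', h4', h5'⟩ := hd y' hy'
      have hp : p y = p y' :=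
        eq_of_add_mul_eq (j := j) (I := I y') (J := I y) (k := k) h1 (by omega) h1' (by omega)
          (by linarith)
      rcases lt_trichotomy y y' with hyy | hyy | hyy
      · exact (h5' y (by omega) hyy (by rw [h4.2.1, hp])).elim
      · exact hyy
      · exact (h5 y' (by omega) hyy (by rw [h4'.2.1, hp])).elim
    · intro y hy y' hy' _ _ he
      obtain ⟨h1, h2, h3, h4, h5⟩ := hd y hy
      obtain ⟨h1', h2', h3', h4', h5'⟩ := hd y' hy'
      exact eq_of_add_mul_eq (j := j + 1) (by omega) (by omega) (by omega) (by omega) he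
    -- Two chains that both reach the ends would span more than `n - 2 k`.
    · intro y hy
      by_contra! hcon
      obtain ⟨h1, h2, h3, h4, h5⟩ := hd y hy
      have := (h.span_of_chains h4 h2 (hI y hy) (hJ y hy) hj h1 h3 h5 (by linarith)).1
      linarith [hcon.1, hcon.2]
  -- The counting is now tight: every vertex of `R` or `L` ends a chain whose opposite chain reaches
  -- the end of the path. Apply this to a class that starts near `n` and to one that ends near `1`.
  obtain ⟨s, hs0, hsn, hs⟩ := h.exists_last_start (hj j le_rfl (by omega))
  obtain ⟨s', hs0', hsn', hs'⟩ := h.exists_first_end (hj j le_rfl (by omega))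
  by_cases hsR : j + k < s
  · obtain ⟨y, hy, hDy, hys⟩ := r2 s ((hmR s).2 ⟨hsR, hs0, hs⟩)
    obtain ⟨h1, h2, h3, h4, h5⟩ := hd y hy
    by_cases hsL : s' < j
    · obtain ⟨y', hy', hDy', hys'⟩ := r1 s' ((hmL s').2 ⟨hsL, hs0', hs'⟩)
      obtain ⟨h1', h2', h3', h4', h5'⟩ := hd y' hy'
      have hnL : p y - I y * k ≤ k := by
        by_contra! hcon
        exact r3 y hy hcon hDy
      have hnR : n < y' + J y' * k + k := by
        by_contra! hcon
        exact r3 y' hy' hDy' hcon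
      obtain ⟨-, e1, e2⟩ := h.span_of_chains h4 h2 (hI y hy) (hJ y hy) hj h1 h3 h5 (by linarith)
      obtain ⟨-, e1', e2'⟩ := h.span_of_chains h4' h2' (hI y' hy') (hJ y' hy') hj h1' h3' h5'
        (by linarith)
      -- Each pair leaves a single vertex of the other colour, the one between its two members. With
      -- equal colours the pairs coincide, against `r3`; with different colours both members of one
      -- pair would be that single vertex.
      by_cases hc : κ (p y') = κ (p y)
      · obtain ⟨c, -, -, hc0, hcc⟩ := h.exists_color_ne hj (κ (p y))
        have f1 := e2 c hc0 hcc
        have f2 := e2' c hc0 (by rwa [hc])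
        have : y = y' := by omega
        subst this
        exact r3 y hy hDy' hDy
      · have f1 := e2 (p y') h4'.1 hc
        have f2 := e2 y' h4'.symm.1 (by rwa [h4'.2.1])
        omega
    · exact h.not_chain_right h4 h2 (hJ y hy) hj (by omega) (by linarith)
  · by_cases hsL : s' < j
    · obtain ⟨y', hy', hDy', hys'⟩ := r1 s' ((hmL s').2 ⟨hsL, hs0', hs'⟩)
      obtain ⟨h1', h2', h3', h4', h5'⟩ := hd y' hy'
      exact h.not_chain_left h4' h2' (hI y' hy') hj (by omega) (by linarith)
    -- Here `n - k ≤ s ≤ j + k` and `j ≤ s' ≤ k + 1`, so `n ≤ 3 k + 1`.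
    · omega

end Coloring

/-! ### Unions of labelled subgraphs of a path power -/

/-- The disjoint vertex sets `A` and `D` of the operands of a union in an expression for the path
power with vertices `1, …, n`: vertices with equal labels have the same neighbours that are not yet
created, and adjacencies between `A` and `D` depend on the labels only. -/
structure IsUnion (k n : ℤ) {L : Type*} (A D : ℤ → Prop) (lab : ℤ → L) : Prop where
  range : ∀ x, A x ∨ D x → 1 ≤ x ∧ x ≤ n
  disjoint : ∀ x, A x → ¬ D x
  out : ∀ x y, A x ∨ D x → A y ∨ D y → lab x = lab y → ∀ z, 1 ≤ z → z ≤ n → ¬ A z → ¬ D z →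
    |z - x| ≤ k → |z - y| ≤ k
  cross : ∀ x z x' z', A x → D z → A x' ∨ D x' → A z' ∨ D z' → lab x' = lab x → lab z' = lab z →
    |x - z| ≤ k → x' ≠ z' ∧ |x' - z'| ≤ k

namespace IsUnion

variable {k n : ℤ} {L : Type*} {A D : ℤ → Prop} {lab : ℤ → L} {x y z i j : ℤ}

theorem swap (h : IsUnion k n A D lab) : IsUnion k n D A lab where
  range x hx := h.range x hx.symm
  disjoint x hx hx' := h.disjoint x hx' hx
  out x y hx hy hxy z h1 h2 h3 h4 := h.out x y hx.symm hy.symm hxy z h1 h2 h4 h3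
  cross x z x' z' hx hz hx' hz' h1 h2 h3 := by
    have := h.cross z x z' x' hz hx hz'.symm hx'.symm h2 h1 (by rwa [abs_sub_comm])
    rw [abs_sub_comm]
    exact ⟨this.1.symm, this.2⟩

theorem reflect (h : IsUnion k n A D lab) :
    IsUnion k n (fun x => A (n + 1 - x)) (fun x => D (n + 1 - x)) fun x => lab (n + 1 - x) where
  range x hx := by
    have := h.range _ hx
    omega
  disjoint x := h.disjoint _
  out x y hx hy hxy z h1 h2 h3 h4 h5 := by
    have := h.out _ _ hx hy hxy (n + 1 - z) (by omega) (by omega) h3 h4 (by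
      rw [abs_le] at *
      omega)
    rw [abs_le] at *
    omega
  cross x z x' z' hx hz hx' hz' h1 h2 h3 := by
    have := h.cross _ _ _ _ hx hz hx' hz' h1 h2 (by
      rw [abs_le] at *
      omega)
    rw [abs_le] at *
    omega

theorem near_of_lab_eq (h : IsUnion k n A D lab) (hx : A x) (hy : A y ∨ D y)
    (hxy : lab x = lab y) (h1 : 1 ≤ z) (h2 : z ≤ n) (hz : ¬ A z) (hzx : |z - x| ≤ k) :
    |z - y| ≤ k := by
  by_cases hzD : D z
  · rw [abs_sub_comm]
    exact (h.cross x z y z hx hzD hy (Or.inr hzD) hxy.symm rfl (by rwa [abs_sub_comm])).2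
  · exact h.out x y (Or.inl hx) hy hxy z h1 h2 hz hzD hzx

/-- An edge between `x` and `y` would still be missing at the union and would need a join of their
common label with itself. -/
theorem far_of_lab_eq (h : IsUnion k n A D lab) (hx : A x) (hy : D y) (hxy : lab x = lab y) :
    x + k < y ∨ y + k < x := by
  by_contra! hcon
  exact (h.cross x y y y hx hy (Or.inr hy) (Or.inr hy) hxy.symm rfl
    (abs_le.2 ⟨by omega, by omega⟩)).1 rfl

/-- `v` is the first vertex of `A` in its residue class modulo `K`, counted from the gap; the window
meets every class. -/
theorem exists_rep_aux {K : ℕ} (hK : 0 < K) (hiA : ∀ z, i ≤ z → z < i + K → ¬ A z)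
    (hj : i + K ≤ j) (hjA : ∀ z, j ≤ z → z ≤ j + K → A z) {r : ℕ} (hr : r < K) :
    ∃ v, A v ∧ i + K ≤ v ∧ v < j + K ∧ ¬ A (v - K) ∧ ∃ m : ℕ, v = i + r + m * K := by
  classical
  have hK' : (0 : ℤ) < K := by exact_mod_cast hK
  have hex : ∃ m : ℕ, A (i + r + m * K) ∧ i + r + m * K < j + K := by
    have h1 := Int.emod_add_mul_ediv (j + K - 1 - (i + r)) K
    have h2 := Int.emod_nonneg (j + K - 1 - (i + r)) hK'.ne'
    have h3 := Int.emod_lt_of_pos (j + K - 1 - (i + r)) hK'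
    have h4 : 0 ≤ (j + K - 1 - (i + r)) / K := Int.ediv_nonneg (by omega) hK'.le
    refine ⟨((j + K - 1 - (i + r)) / K).toNat, ?_⟩
    rw [Int.toNat_of_nonneg h4, mul_comm]
    exact ⟨hjA _ (by omega) (by omega), by omega⟩
  have hm := Nat.find_spec hex
  rcases hm0 : Nat.find hex with _ | m
  · rw [hm0] at hm
    exact (hiA _ (by omega) (by push_cast; omega) hm.1).elim
  · have hm' := Nat.find_min hex (m := m) (by omega)
    rw [hm0] at hm
    have e : i + r + ((m + 1 : ℕ) : ℤ) * K - K = i + r + m * K := by push_cast; ring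
    have h0 : (0 : ℤ) ≤ m * K := by positivity
    refine ⟨_, hm.1, ?_, hm.2, ?_, m + 1, rfl⟩
    · linarith
    · rw [e]
      exact fun h => hm' ⟨h, by linarith [hm.2]⟩

/-- If `A` has an interval of `k + 1` vertices and its complement an interval of `k` vertices to
the left of it, then `A` uses all of the `k + 1` labels. -/
theorem exists_rep {K : ℕ} {lab : ℤ → Fin (K + 1)} (h : IsUnion K n A D lab) (hK : 0 < K)
    (hi1 : 1 ≤ i) (hiA : ∀ z, i ≤ z → z < i + K → ¬ A z) (hj : i + K ≤ j)
    (hjA : ∀ z, j ≤ z → z ≤ j + K → A z) (l : Fin (K + 1)) :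
    ∃ v, A v ∧ lab v = l ∧ v ≤ j + K ∧ (v = j + K ∨ (i + K ≤ v ∧ ¬ A (v - K))) := by
  have hex : ∀ r : Fin (K + 1), ∃ v, A v ∧ i + K ≤ v ∧ v ≤ j + K ∧
      ((v = j + K ∧ (r : ℕ) = K) ∨
        (v < j + K ∧ ¬ A (v - K) ∧ (r : ℕ) < K ∧ ∃ m : ℕ, v = i + (r : ℕ) + m * K)) := by
    intro r
    rcases (Nat.lt_succ_iff.1 r.2).lt_or_eq with hr | hr
    · obtain ⟨v, h1, h2, h3, h4, h5⟩ := exists_rep_aux hK hiA hj hjA hr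
      exact ⟨v, h1, h2, h3.le, Or.inr ⟨h3, h4, hr, h5⟩⟩
    · exact ⟨j + K, hjA _ (by omega) le_rfl, by omega, le_rfl, Or.inl ⟨rfl, hr⟩⟩
  choose v hvA hvi hvj hv using hex
  -- `v r - K` is outside `A`, adjacent to `v r`, and too far from the larger `v s`. So the `K`
  -- first vertices and `j + K` have `K + 1` different labels.
  have hlt : ∀ r s, v r < v s → lab (v r) ≠ lab (v s) := by
    intro r s hrs hl
    have := hvj s
    rcases hv r with ⟨h1, -⟩ | ⟨h1, h2, -⟩
    · omega
    · have h3 := hvi r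
      have h4 := h.range _ (Or.inl (hvA r))
      have := h.near_of_lab_eq (hvA r) (Or.inl (hvA s)) hl (z := v r - K) (by omega) (by omega) h2
        (by rw [abs_le]; omega)
      rw [abs_le] at this
      omega
  have hinj : Function.Injective fun r => lab (v r) := by
    intro r s hrs
    rcases lt_trichotomy (v r) (v s) with h1 | h1 | h1
    · exact (hlt r s h1 hrs).elim
    · rcases hv r with ⟨h2, h3⟩ | ⟨h2, -, h3, m, h4⟩ <;>
        rcases hv s with ⟨h2', h3'⟩ | ⟨h2', -, h3', m', h4'⟩
      · exact Fin.ext (h3.trans h3'.symm)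
      · omega
      · omega
      · have := Coloring.eq_of_add_mul_eq (k := K) (j := i) (a := i + (r : ℕ)) (b := i + (s : ℕ))
          (I := m) (J := m') (by omega) (by omega) (by omega) (by omega) (by linarith)
        exact Fin.ext (by omega)
    · exact (hlt s r h1 hrs.symm).elim
  obtain ⟨r, hr⟩ := Finite.injective_iff_surjective.1 hinj l
  refine ⟨v r, hvA r, hr, hvj r, ?_⟩
  rcases hv r with ⟨h1, -⟩ | ⟨-, h1, -⟩
  · exact Or.inl h1
  · exact Or.inr ⟨hvi r, h1⟩

theorem lab_ne_of_consecutive (h : IsUnion k n A D lab) (hx : D x) (hy : D y)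
    (h1 : 1 ≤ z) (h2 : z ≤ n) (hz : ¬ D z) (hzx : |z - x| ≤ k) (hzy : k < |z - y|) :
    lab x ≠ lab y := fun hl =>
  hzy.not_ge (h.swap.near_of_lab_eq hx (Or.inl hy) hl h1 h2 hz hzx)

theorem eq_one_or_eq {K : ℕ} {lab : ℤ → Fin (K + 1)} (h : IsUnion K n A D lab) (hK : 2 ≤ K)
    (hi1 : 1 ≤ i) (hiA : ∀ z, i ≤ z → z < i + K → ¬ A z) (hj : i + K ≤ j)
    (hjA : ∀ z, j ≤ z → z ≤ j + K → A z) (hx : D x) : x = 1 ∨ x = n := by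
  have hjn := (h.range _ (Or.inl (hjA (j + K) (by omega) le_rfl))).2
  -- The representative `v` of the label of `d` is not adjacent to `d`. If `v - K` is outside `A`,
  -- it must be near `d`, so `d` is to the left of `v`; only `v = j + K` allows `d` on the right.
  have key : ∀ d, D d → (lab d = lab (j + K) ∧ j + 2 * K < d) ∨
      ∃ v, A v ∧ lab v = lab d ∧ d + K < v ∧ v ≤ j + K := by
    intro d hd
    obtain ⟨v, h1, h2, h3, h4⟩ := h.exists_rep (by omega) hi1 hiA hj hjA (lab d)
    have h5 := h.far_of_lab_eq h1 hd h2
    rcases h4 with rfl | ⟨h4, h6⟩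
    · rcases h5 with h5 | h5
      · exact Or.inl ⟨h2.symm, by omega⟩
      · exact Or.inr ⟨_, h1, h2, h5, le_rfl⟩
    · have h7 := h.near_of_lab_eq h1 (Or.inr hd) h2 (z := v - K) (by omega)
        (by have := h.range _ (Or.inl h1); omega) h6 (by rw [abs_le]; omega)
      rw [abs_le] at h7
      exact Or.inr ⟨v, h1, h2, by omega, h3⟩
  rcases key x hx with ⟨h1, h2⟩ | ⟨v, h1, h2, h3, h4⟩
  · right
    by_contra hxn
    have hxn' := (h.range x (Or.inr hx)).2
    -- For the least such `m`, also `m + 1` is in `D` with the label of `j + K`, although `m - K` is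
    -- adjacent to `m` only.
    obtain ⟨m, ⟨hm1, hm2⟩, hm3⟩ := Int.exists_least_of_bdd (P := fun d => D d ∧ j + 2 * K < d)
      ⟨1, fun z hz => (h.range z (Or.inr hz.1)).1⟩ ⟨x, hx, h2⟩
    have hmx := hm3 x ⟨hx, h2⟩
    have hml : lab m = lab (j + K) := by
      rcases key m hm1 with h5 | ⟨v, -, -, h5, h6⟩
      · exact h5.1
      · omega
    have hA := hjA (j + K) (by omega) le_rfl
    have hD : D (m + 1) := by
      by_contra hD
      have := h.swap.near_of_lab_eq hm1 (Or.inr hA) hml (z := m + 1) (by omega) (by omega) hD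
        (by rw [abs_le]; omega)
      rw [abs_le] at this
      omega
    have hml' : lab (m + 1) = lab (j + K) := by
      rcases key (m + 1) hD with h5 | ⟨v, -, -, h5, h6⟩
      · exact h5.1
      · omega
    have hD' : ¬ D (m - K) := by
      intro hD'
      rcases key _ hD' with ⟨-, h5⟩ | ⟨v, -, -, h5, h6⟩
      · have := hm3 _ ⟨hD', h5⟩
        omega
      · omega
    exact h.lab_ne_of_consecutive hm1 hD (z := m - K) (by omega) (by omega) hD'
      (by rw [abs_le]; omega) (by rw [lt_abs]; omega) (hml.trans hml'.symm)
  · left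
    by_contra hx1
    have hx1' := (h.range x (Or.inr hx)).1
    have hxj : x < j := by omega
    -- For the last such `m`, the vertices of `A` labelled like `m` and `m - 1` must be `v = m + K +
    -- 1` and `w = m + K`. The edge between `w` and `m` then forces one between `m - 1` and `v`, at
    -- distance `K + 2`.
    obtain ⟨m, ⟨hm1, hm2⟩, hm3⟩ := Int.exists_greatest_of_bdd (P := fun d => D d ∧ d < j)
      ⟨j, fun z hz => hz.2.le⟩ ⟨x, hx, hxj⟩
    have hmx := hm3 x ⟨hx, hxj⟩
    have hout : ∀ d, m < d → d ≤ j + 2 * K → ¬ D d := by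
      intro d h5 h6 hd
      rcases key d hd with ⟨-, h7⟩ | ⟨v, -, -, h7, h8⟩
      · omega
      · have := hm3 d ⟨hd, by omega⟩
        omega
    obtain ⟨v, hv1, hv2, hv3, -⟩ := (key m hm1).resolve_left (by omega)
    have hvm := h.swap.near_of_lab_eq hm1 (Or.inr hv1) hv2.symm (z := m + 1) (by omega) (by omega)
      (hout _ (by omega) (by omega)) (by rw [abs_le]; omega)
    have hD : D (m - 1) := by
      by_contra hD
      have := h.swap.near_of_lab_eq hm1 (Or.inr hv1) hv2.symm (z := m - 1) (by omega) (by omega)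
        hD (by rw [abs_le]; omega)
      rw [abs_le] at this
      omega
    obtain ⟨w, hw1, hw2, hw3, -⟩ := (key (m - 1) hD).resolve_left (by omega)
    have hwm := h.swap.near_of_lab_eq hD (Or.inr hw1) hw2.symm (z := m + 1) (by omega) (by omega)
      (hout _ (by omega) (by omega)) (by rw [abs_le]; omega)
    have hne := h.lab_ne_of_consecutive hm1 hD (z := m + K) (by omega) (by omega)
      (hout _ (by omega) (by omega)) (by rw [abs_le]; omega) (by rw [lt_abs]; omega)
    rw [abs_le] at hvm hwm
    have hvw : v ≠ w := by
      rintro rfl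
      exact hne (hv2.symm.trans hw2)
    have := h.cross w m (m - 1) v hw1 hm1 (Or.inr hD) (Or.inl hv1) hw2.symm hv2
      (by rw [abs_le]; omega)
    rw [abs_le] at this
    omega

end IsUnion

/-! ### Windows and gaps -/

/-- `A` contains `k + 1` consecutive integers. -/
def HasWindow (k : ℤ) (A : ℤ → Prop) : Prop :=
  ∃ j, ∀ z, j ≤ z → z ≤ j + k → A z

/-- `A` avoids `k` consecutive inner vertices. -/
def HasGap (k n : ℤ) (A : ℤ → Prop) : Prop :=
  ∃ i, 2 ≤ i ∧ i + k ≤ n ∧ ∀ z, i ≤ z → z < i + k → ¬ A z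

namespace IsUnion

variable {n : ℤ} {A D : ℤ → Prop} {K : ℕ} {x y : ℤ}

/-- The other operand is confined to the two ends of the path, and a gap consists of inner vertices.
-/
theorem hasGap_of_hasGap {lab : ℤ → Fin (K + 1)} (h : IsUnion K n A D lab) (hK : 2 ≤ K)
    (hw : HasWindow K A) (hg : HasGap K n A) : HasGap K n fun x => A x ∨ D x := by
  obtain ⟨j, hj⟩ := hw
  obtain ⟨i, hi1, hin, hi⟩ := hg
  suffices H : ∀ x, D x → x = 1 ∨ x = n from
    ⟨i, hi1, hin, fun z h1 h2 hz => hz.elim (hi z h1 h2) fun hz => by have := H z hz; omega⟩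
  intro x hx
  by_cases hij : i + K ≤ j
  · exact h.eq_one_or_eq hK (by omega) hi hij hj hx
  · have hji : j + K < i := by
      by_contra! hji
      exact hi (max i j) (by omega) (by omega) (hj _ (by omega) (by omega))
    have := h.reflect.eq_one_or_eq hK (i := n + 2 - i - K) (j := n + 1 - j - K) (by omega)
      (fun z h1 h2 => hi _ (by omega) (by omega)) (by omega)
      (fun z h1 h2 => hj _ (by omega) (by omega)) (x := n + 1 - x) (by simpa using hx)
    omega

/-- With a common label, neighbours of `x` only lie in `A` and neighbours of `y` only lie in `D`.
This gives a window on one side of `x` or `y`; close to the ends of the path, `x, …, x + K` is one.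
-/
theorem lab_ne_of_lt {L : Type*} {lab : ℤ → L} (h : IsUnion K n A D lab) (hn : 4 * (K : ℤ) ≤ n)
    (hA : ¬ HasWindow K A) (hD : ¬ HasWindow K D) (hx : A x) (hy : D y) (hxy : x < y) :
    lab x ≠ lab y := by
  intro hl
  have hfar := (h.far_of_lab_eq hx hy hl).resolve_right (by omega)
  have hx1 := h.range x (Or.inl hx)
  have hy1 := h.range y (Or.inr hy)
  have hA' : ∀ z, 1 ≤ z → z ≤ n → x - K ≤ z → z ≤ x + K → (z < y - K ∨ y + K < z) → A z := by
    intro z h1 h2 h3 h4 h5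
    by_contra hz
    have := h.near_of_lab_eq hx (Or.inr hy) hl h1 h2 hz (by rw [abs_le]; omega)
    rw [abs_le] at this
    omega
  have hD' : ∀ z, 1 ≤ z → z ≤ n → y - K ≤ z → z ≤ y + K → (z < x - K ∨ x + K < z) → D z := by
    intro z h1 h2 h3 h4 h5
    by_contra hz
    have := h.swap.near_of_lab_eq hy (Or.inr hx) hl.symm h1 h2 hz (by rw [abs_le]; omega)
    rw [abs_le] at this
    omega
  have h1 : x ≤ K := by
    by_contra! h1
    exact hA ⟨x - K, fun z h2 h3 => hA' z (by omega) (by omega) h2 (by omega) (by omega)⟩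
  have h2 : n < y + K := by
    by_contra! h2
    exact hD ⟨y, fun z h3 h4 => hD' z (by omega) (by omega) (by omega) h4 (by omega)⟩
  exact hA ⟨x, fun z h3 h4 => hA' z (by omega) (by omega) (by omega) h4 (by omega)⟩

/-- Colour the vertices by operand. Since the operands share no label, equal labels imply `Twin`, so
the number of labels bounds the twin classes; the missing windows and gap give the remaining
conditions of `Coloring`. -/
theorem hasGap_of_not_hasWindow {lab : ℤ → Fin (K + 1)} (h : IsUnion K n A D lab) (hK : 2 ≤ K)
    (hn : n = K * (K + 1) + 2) (hA : ¬ HasWindow K A) (hD : ¬ HasWindow K D)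
    (hw : HasWindow K fun x => A x ∨ D x) : HasGap K n fun x => A x ∨ D x := by
  classical
  by_contra hg
  have hK' : (2 : ℤ) ≤ K := by exact_mod_cast hK
  have hn4 : 4 * (K : ℤ) ≤ n := by
    rw [hn]
    nlinarith
  let κ : ℤ → ℕ := fun x => if A x then 1 else if D x then 2 else 0
  have hκ0 : ∀ x, κ x ≠ 0 ↔ A x ∨ D x := fun x => by
    simp only [κ]
    split_ifs <;> simp [*]
  have hκ1 : ∀ x, κ x = 1 ↔ A x := fun x => by
    simp only [κ]
    split_ifs <;> simp [*]
  have hκ2 : ∀ x, κ x = 2 ↔ D x := fun x => by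
    have := h.disjoint x
    simp only [κ]
    split_ifs <;> simp_all
  have htwin : ∀ x y, A x ∨ D x → A y ∨ D y → lab x = lab y → Twin K n κ x y := by
    intro x y hx hy hl
    have hne : ∀ x y, A x → D y → lab x ≠ lab y := by
      intro x y hx hy
      rcases lt_trichotomy x y with hxy | rfl | hxy
      · exact h.lab_ne_of_lt hn4 hA hD hx hy hxy
      · exact (h.disjoint _ hx hy).elim
      · exact (h.swap.lab_ne_of_lt hn4 hD hA hy hx hxy).symm
    refine ⟨(hκ0 x).2 hx, ?_, fun z h1 h2 hz => ?_⟩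
    · rcases hx with hx | hx <;> rcases hy with hy | hy
      · rw [(hκ1 x).2 hx, (hκ1 y).2 hy]
      · exact (hne x y hx hy hl).elim
      · exact (hne y x hy hx hl.symm).elim
      · rw [(hκ2 x).2 hx, (hκ2 y).2 hy]
    · rcases hx with hx | hx <;> rcases hy with hy | hy
      · rw [(hκ1 x).2 hx, Ne, hκ1] at hz
        exact ⟨h.near_of_lab_eq hx (Or.inl hy) hl h1 h2 hz,
          h.near_of_lab_eq hy (Or.inl hx) hl.symm h1 h2 hz⟩
      · exact (hne x y hx hy hl).elim
      · exact (hne y x hy hx hl.symm).elim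
      · rw [(hκ2 x).2 hx, Ne, hκ2] at hz
        exact ⟨h.swap.near_of_lab_eq hx (Or.inl hy) hl h1 h2 hz,
          h.swap.near_of_lab_eq hy (Or.inl hx) hl.symm h1 h2 hz⟩
  have hcol : Coloring K n κ := by
    refine ⟨hK', hn, fun x hx => h.range x ((hκ0 x).1 hx), fun j hj => ?_, fun i hi hin => ?_,
      fun S hS hS' => ?_⟩
    · by_contra! hcon
      rcases (hκ0 j).1 hj with hj | hj
      · refine hA ⟨j, fun z h1 h2 => ?_⟩
        rw [← hκ1, hcon z h1 h2, hκ1]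
        exact hj
      · refine hD ⟨j, fun z h1 h2 => ?_⟩
        rw [← hκ2, hcon z h1 h2, hκ2]
        exact hj
    · by_contra! hcon
      exact hg ⟨i, hi, hin, fun z h1 h2 hz => (hκ0 z).2 hz (hcon z h1 h2)⟩
    · have := Finset.card_le_card_of_injOn (t := Finset.univ) lab (fun _ _ => Finset.mem_univ _)
        (s := S) (by
          intro x hx y hy hxy
          have h1 := (hκ0 x).1 (hS x hx)
          have h2 := (hκ0 y).1 (hS y hy)
          rcases lt_trichotomy x y with h3 | h3 | h3
          · exact (hS' x hx y hy h3 (htwin x y h1 h2 hxy)).elim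
          · exact h3
          · exact (hS' y hy x hx h3 (htwin y x h2 h1 hxy.symm)).elim)
      rw [Finset.card_univ, Fintype.card_fin] at this
      exact_mod_cast this
  obtain ⟨j, hj⟩ := hw
  obtain ⟨z, h1, h2, h3⟩ := hcol.exists_eq_zero j
  exact (hκ0 z).2 (hj z h1 h2) h3

theorem hasGap {lab : ℤ → Fin (K + 1)} (h : IsUnion K n A D lab) (hK : 2 ≤ K)
    (hn : n = K * (K + 1) + 2) (hA : HasWindow K A → HasGap K n A)
    (hD : HasWindow K D → HasGap K n D) (hw : HasWindow K fun x => A x ∨ D x) :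
    HasGap K n fun x => A x ∨ D x := by
  by_cases hA' : HasWindow K A
  · exact h.hasGap_of_hasGap hK hA' (hA hA')
  · by_cases hD' : HasWindow K D
    · have := h.swap.hasGap_of_hasGap hK hD' (hD hD')
      simpa only [or_comm] using this
    · exact h.hasGap_of_not_hasWindow hK hn hA' hD' hw

end IsUnion

/-! ### Subexpressions of an expression that defines a graph -/

namespace CliqueExpr

variable {V : Type*} {m : ℕ}

/-- The labelled graph defined by `e` can be extended to `G`: vertices with equal labels have the
same neighbours among the vertices not yet created, and whether an edge between created vertices is
still missing depends on the labels only. -/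
structure Compatible (G : SimpleGraph V) (e : CliqueExpr V m) : Prop where
  graph_le : e.graph ≤ G
  outside : ∀ u w a, e.HasLabel u a → e.HasLabel w a → ∀ z, z ∉ e.verts → G.Adj u z → G.Adj w z
  missing : ∀ u w u' w' a b, e.HasLabel u a → e.HasLabel u' a → e.HasLabel w b → e.HasLabel w' b →
    G.Adj u w → ¬ e.graph.Adj u w → G.Adj u' w'

variable {G : SimpleGraph V} {e f : CliqueExpr V m} {i j : Fin m}

theorem Defines.compatible (h : e.Defines G) : e.Compatible G where
  graph_le := h.2.2.le
  outside _ _ _ _ _ z hz := by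
    rw [h.2.1] at hz
    exact (hz trivial).elim
  missing _ _ _ _ _ _ _ _ _ _ h1 h2 := by
    rw [h.2.2] at h2
    exact (h2 h1).elim

theorem Compatible.cross (h : (union e f).Compatible G) (hd : Disjoint e.verts f.verts)
    {x z x' z' : V} {a b : Fin m} (hx : e.HasLabel x a) (hz : f.HasLabel z b)
    (hx' : (union e f).HasLabel x' a) (hz' : (union e f).HasLabel z' b) (ha : G.Adj x z) :
    G.Adj x' z' := by
  refine h.missing x z x' z' a b (Or.inl hx) hx' (Or.inr hz) hz' ha ?_
  rintro (h1 | h1)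
  · exact Set.disjoint_left.1 hd (mem_verts_of_adj h1).2 hz.mem_verts
  · exact Set.disjoint_left.1 hd hx.mem_verts (mem_verts_of_adj h1).1

theorem Compatible.union_left (h : (union e f).Compatible G) (hd : Disjoint e.verts f.verts) :
    e.Compatible G where
  graph_le := le_sup_left.trans h.graph_le
  outside u w a hu hw z hz ha := by
    by_cases hzf : z ∈ f.verts
    · obtain ⟨b, hb⟩ := exists_hasLabel hzf
      exact h.cross hd hu hb (Or.inl hw) (Or.inr hb) ha
    · exact h.outside u w a (Or.inl hu) (Or.inl hw) z (fun h => h.elim hz hzf) ha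
  missing u w u' w' a b hu hu' hw hw' ha hn := by
    refine h.missing u w u' w' a b (Or.inl hu) (Or.inl hu') (Or.inl hw) (Or.inl hw') ha ?_
    rintro (h1 | h1)
    · exact hn h1
    · exact Set.disjoint_left.1 hd hu.mem_verts (mem_verts_of_adj h1).1

theorem Compatible.union_comm (h : (union e f).Compatible G) : (union f e).Compatible G where
  graph_le := by
    have := h.graph_le
    rwa [graph, sup_comm] at this
  outside u w a hu hw z hz := h.outside u w a hu.symm hw.symm z fun hz' => hz hz'.symm
  missing u w u' w' a b hu hu' hw hw' ha hn :=
    h.missing u w u' w' a b hu.symm hu'.symm hw.symm hw'.symm ha fun hn' => hn (Or.symm hn')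

/-- An edge added by this join is added for all vertices with its two labels, so whether it is
missing before the join depends on the labels only. -/
theorem Compatible.of_join (h : (join i j e).Compatible G) (hw : (join i j e).WellFormed) :
    e.Compatible G where
  graph_le := le_sup_left.trans h.graph_le
  outside := h.outside
  missing u w u' w' a b hu hu' hv hv' ha hn := by
    have hij : ∀ {u w}, e.HasLabel u i → e.HasLabel w j → G.Adj u w := by
      intro u w hu hw'
      refine h.graph_le (Or.inr ⟨?_, Or.inl ⟨hu, hw'⟩⟩)
      rintro rfl
      exact hw.1 (hu.unique hw.2 hw')
    by_cases hj : (join i j e).graph.Adj u w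
    · rcases hj.resolve_left hn with ⟨-, ⟨h1, h2⟩ | ⟨h1, h2⟩⟩
      · obtain rfl := hu.unique hw.2 h1
        obtain rfl := hv.unique hw.2 h2
        exact hij hu' hv'
      · obtain rfl := hu.unique hw.2 h2
        obtain rfl := hv.unique hw.2 h1
        exact (hij hv' hu').symm
    · exact h.missing u w u' w' a b hu hu' hv hv' ha hj

theorem Compatible.of_relabel (h : (relabel i j e).Compatible G) : e.Compatible G := by
  have hlab : ∀ {u a}, e.HasLabel u a → (relabel i j e).HasLabel u (if a = i then j else a) := by
    intro u a hu
    split_ifs with ha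
    · exact Or.inr ⟨ha ▸ hu, rfl⟩
    · exact Or.inl ⟨hu, ha⟩
  exact ⟨h.graph_le, fun u w a hu hw => h.outside u w _ (hlab hu) (hlab hw),
    fun u w u' w' a b hu hu' hw hw' =>
      h.missing u w u' w' _ _ (hlab hu) (hlab hu') (hlab hw) (hlab hw')⟩

theorem verts_nonempty (e : CliqueExpr V m) : e.verts.Nonempty := by
  induction e with
  | vertex i v => exact ⟨v, rfl⟩
  | union e f ihe ihf => exact ihe.inl
  | join i j e ih => exact ih
  | relabel i j e ih => exact ih

/-- An expression for a graph contains a last union. -/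
theorem exists_union_of_defines [Nontrivial V] (h : e.Defines G) :
    ∃ e₁ e₂ : CliqueExpr V m, e₁.WellFormed ∧ e₂.WellFormed ∧ Disjoint e₁.verts e₂.verts ∧
      e₁.verts ∪ e₂.verts = Set.univ ∧ (union e₁ e₂).Compatible G := by
  suffices H : ∀ e : CliqueExpr V m, e.WellFormed → e.verts = Set.univ → e.Compatible G →
    ∃ e₁ e₂ : CliqueExpr V m, e₁.WellFormed ∧ e₂.WellFormed ∧ Disjoint e₁.verts e₂.verts ∧
      e₁.verts ∪ e₂.verts = Set.univ ∧ (union e₁ e₂).Compatible G from H e h.1 h.2.1 h.compatible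
  intro e
  induction e with
  | vertex i v =>
    intro _ hv _
    obtain ⟨w, hw⟩ := exists_ne v
    exact (hw (hv.symm ▸ Set.mem_univ w : w ∈ (vertex i v : CliqueExpr V m).verts)).elim
  | union e f ihe ihf => exact fun hw hv hc => ⟨e, f, hw.1, hw.2.1, hw.2.2, hv, hc⟩
  | join i j e ih => exact fun hw hv hc => ih hw.2 hv (hc.of_join hw)
  | relabel i j e ih => exact fun hw hv hc => ih hw hv hc.of_relabel

/-! ### Expressions for path powers -/

/-- The positions `1, …, n` of the vertices of an expression. -/
def Position {n : ℕ} (e : CliqueExpr (Fin n) m) (x : ℤ) : Prop :=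
  ∃ u ∈ e.verts, x = ((u : ℕ) : ℤ) + 1

theorem adj_iff_abs_le {k n : ℕ} {u w : Fin n} : (pathPower k n).Adj u w ↔
    u ≠ w ∧ |((u : ℕ) + 1 : ℤ) - ((w : ℕ) + 1)| ≤ k := by
  rw [pathPower_adj, abs_le, ne_eq, ne_eq, Fin.ext_iff]
  omega

/-- Positions without a created vertex get the arbitrary label `0`; `IsUnion` only looks at labels
of created vertices. -/
theorem Compatible.isUnion {k K n : ℕ} {e f : CliqueExpr (Fin n) m} (hm : m ≤ K + 1)
    (h : (union e f).Compatible (pathPower k n)) (hw : (union e f).WellFormed) :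
    ∃ lab : ℤ → Fin (K + 1), IsUnion k n e.Position f.Position lab := by
  have hd := hw.2.2
  have hlab : ∀ x : ℤ, ∃ l : Fin (K + 1), ∀ u ∈ e.verts ∪ f.verts, x = ((u : ℕ) : ℤ) + 1 →
      ∀ a, (union e f).HasLabel u a → Fin.castLE hm a = l := by
    intro x
    by_cases hx : ∃ u ∈ e.verts ∪ f.verts, x = ((u : ℕ) : ℤ) + 1
    · obtain ⟨u, hu, rfl⟩ := hx
      obtain ⟨a, ha⟩ := exists_hasLabel (e := union e f) hu
      refine ⟨Fin.castLE hm a, fun w _ huw b hb => ?_⟩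
      obtain rfl : u = w := Fin.ext (by omega)
      rw [ha.unique hw hb]
    · exact ⟨0, fun u hu hxu => (hx ⟨u, hu, hxu⟩).elim⟩
  choose lab hlab using hlab
  have hlab' : ∀ {u w a b}, (union e f).HasLabel u a → (union e f).HasLabel w b →
      lab (((u : Fin n) : ℕ) + 1) = lab (((w : Fin n) : ℕ) + 1) → a = b := by
    intro u w a b ha hb hl
    rw [← hlab _ u ha.mem_verts rfl a ha, ← hlab _ w hb.mem_verts rfl b hb] at hl
    exact Fin.castLE_injective hm hl
  have hpos : ∀ x, e.Position x ∨ f.Position x → ∃ u, ∃ a, (union e f).HasLabel u a ∧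
      x = ((u : ℕ) : ℤ) + 1 := by
    rintro x (⟨u, hu, hx⟩ | ⟨u, hu, hx⟩)
    · obtain ⟨a, ha⟩ := exists_hasLabel hu
      exact ⟨u, a, Or.inl ha, hx⟩
    · obtain ⟨a, ha⟩ := exists_hasLabel hu
      exact ⟨u, a, Or.inr ha, hx⟩
  refine ⟨lab, ?_, ?_, ?_, ?_⟩
  · intro x hx
    obtain ⟨u, -, -, rfl⟩ := hpos x hx
    have := u.2
    omega
  · rintro x ⟨u, hu, hxu⟩ ⟨w, hw', hxw⟩
    obtain rfl : u = w := Fin.ext (by omega)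
    exact Set.disjoint_left.1 hd hu hw'
  · intro x y hx hy hxy z h1 h2 hze hzf hzx
    obtain ⟨u, a, ha, rfl⟩ := hpos x hx
    obtain ⟨w, b, hb, rfl⟩ := hpos y hy
    obtain rfl := hlab' ha hb hxy
    obtain ⟨v, rfl⟩ : ∃ v : Fin n, z = ((v : ℕ) : ℤ) + 1 :=
      ⟨⟨(z - 1).toNat, by omega⟩, by dsimp only; omega⟩
    have hv : v ∉ (union e f).verts := fun hv =>
      hv.elim (fun hv => hze ⟨v, hv, rfl⟩) fun hv => hzf ⟨v, hv, rfl⟩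
    have := h.outside u w a ha hb v hv (adj_iff_abs_le.2 ⟨?_, by rwa [abs_sub_comm]⟩)
    · rw [abs_sub_comm]
      exact (adj_iff_abs_le.1 this).2
    · rintro rfl
      exact hv ha.mem_verts
  · rintro x z x' z' ⟨u, hu, rfl⟩ ⟨w, hw', rfl⟩ hx' hz' hxx hzz hxz
    obtain ⟨a, ha⟩ := exists_hasLabel hu
    obtain ⟨b, hb⟩ := exists_hasLabel hw'
    obtain ⟨u', a', ha', rfl⟩ := hpos _ hx'
    obtain ⟨w', b', hb', rfl⟩ := hpos _ hz'
    obtain rfl := hlab' ha' (Or.inl ha) hxx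
    obtain rfl := hlab' hb' (Or.inr hb) hzz
    have hne : u ≠ w := by
      rintro rfl
      exact Set.disjoint_left.1 hd hu hw'
    have := adj_iff_abs_le.1 (h.cross hd ha hb ha' hb' (adj_iff_abs_le.2 ⟨hne, hxz⟩))
    refine ⟨fun h0 => this.1 (Fin.ext ?_), this.2⟩
    omega

theorem Compatible.hasGap {K n : ℕ} (hK : 2 ≤ K) (hn : n = K * (K + 1) + 2) (hm : m ≤ K + 1)
    {e : CliqueExpr (Fin n) m} (hw : e.WellFormed) (hc : e.Compatible (pathPower K n))
    (h : HasWindow K e.Position) : HasGap K n e.Position := by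
  induction e with
  | vertex i v =>
    obtain ⟨j, hj⟩ := h
    obtain ⟨u, rfl, h1⟩ := hj j le_rfl (by omega)
    obtain ⟨w, rfl, h2⟩ := hj (j + 1) (by omega) (by omega)
    omega
  | union e f ihe ihf =>
    obtain ⟨lab, hu⟩ := hc.isUnion hm hw
    have hpos : (union e f).Position = fun x => e.Position x ∨ f.Position x := by
      funext x
      simp only [Position, verts, Set.mem_union, or_and_right, exists_or]
    rw [hpos] at h ⊢
    exact hu.hasGap hK (by rw [hn]; push_cast; ring)
      (ihe hw.1 (hc.union_left hw.2.2)) (ihf hw.2.1 (hc.union_comm.union_left hw.2.2.symm)) h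
  | join i j e ih => exact ih hw.2 (hc.of_join hw) h
  | relabel i j e ih => exact ih hw hc.of_relabel h

theorem not_defines_graphZ {k : ℕ} (hk : 2 ≤ k) (hm : m ≤ k + 1)
    (e : CliqueExpr (Fin (k * (k + 1) + 2)) m) : ¬ e.Defines (graphZ k) := by
  intro h
  have hpos : ∀ x : ℤ, 1 ≤ x → x ≤ (k * (k + 1) + 2 : ℕ) → e.Position x := by
    intro x h1 h2
    refine ⟨⟨(x - 1).toNat, by omega⟩, by rw [h.2.1]; trivial, ?_⟩
    dsimp only
    omega
  obtain ⟨i, h1, h2, h3⟩ := h.compatible.hasGap hk rfl hm h.1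
    ⟨1, fun z h1 h2 => hpos z h1 (by push_cast; nlinarith)⟩
  exact h3 i le_rfl (by omega) (hpos i (by omega) (by omega))

/-- At the last union some edge joins the operands, at `p` and `q`. These use both labels, so every
vertex labelled like `p` is near every vertex labelled like `q`. But `1` and `4` are too far apart
for different labels, and no vertex is near both. -/
theorem not_defines_graphZ_one (hm : m ≤ 2) (e : CliqueExpr (Fin 4) m) :
    ¬ e.Defines (graphZ 1) := by
  intro h
  obtain ⟨e₁, e₂, hw₁, hw₂, hd, hu, hc⟩ := exists_union_of_defines h
  obtain ⟨lab, hl⟩ := Compatible.isUnion (K := 1) (k := 1) (n := 4) hm hc ⟨hw₁, hw₂, hd⟩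
  have hpos : ∀ x : ℤ, 1 ≤ x → x ≤ 4 → e₁.Position x ∨ e₂.Position x := by
    intro x h1 h2
    obtain ⟨u, rfl⟩ : ∃ u : Fin 4, x = ((u : ℕ) : ℤ) + 1 :=
      ⟨⟨(x - 1).toNat, by omega⟩, by dsimp only; omega⟩
    exact (hu.symm.subset (Set.mem_univ u)).imp (fun hu => ⟨u, hu, rfl⟩) fun hu => ⟨u, hu, rfl⟩
  -- Otherwise the first operand would contain all of the path or nothing, by moving along its
  -- edges.
  obtain ⟨p, q, hp, hq, hpq⟩ : ∃ p q, e₁.Position p ∧ e₂.Position q ∧ |p - q| ≤ 1 := by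
    by_contra! hcon
    have hstep : ∀ x : ℤ, 1 ≤ x → x < 4 → (e₁.Position x ↔ e₁.Position (x + 1)) := by
      intro x h1 h2
      constructor
      · intro hx
        by_contra hx'
        have := hcon x (x + 1) hx ((hpos _ (by omega) (by omega)).resolve_left hx')
        rw [lt_abs] at this
        omega
      · intro hx
        by_contra hx'
        have := hcon (x + 1) x hx ((hpos _ (by omega) (by omega)).resolve_left hx')
        rw [lt_abs] at this
        omega
    have h1 := hstep 1 (by omega) (by omega)
    have h2 := hstep 2 (by omega) (by omega)
    have h3 := hstep 3 (by omega) (by omega)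
    norm_num at h1 h2 h3
    have hall : ∀ x : ℤ, 1 ≤ x → x ≤ 4 → (e₁.Position x ↔ e₁.Position 1) := by
      intro x hx hx'
      interval_cases x <;> tauto
    obtain ⟨u, hu⟩ := e₁.verts_nonempty
    obtain ⟨w, hw⟩ := e₂.verts_nonempty
    have hu' : e₁.Position (((u : ℕ) : ℤ) + 1) := ⟨u, hu, rfl⟩
    have hw' : e₂.Position (((w : ℕ) : ℤ) + 1) := ⟨w, hw, rfl⟩
    rw [hall _ (by omega) (by omega), ← hall (((w : ℕ) : ℤ) + 1) (by omega) (by omega)] at hu'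
    exact hl.disjoint _ hu' hw'
  have hne : lab p ≠ lab q := fun h => by
    have := hl.far_of_lab_eq hp hq h
    rw [abs_le] at hpq
    push_cast at this
    omega
  have htwo : ∀ x, lab x = lab p ∨ lab x = lab q := by
    intro x
    omega
  have hcross : ∀ x y : ℤ, 1 ≤ x → x ≤ 4 → 1 ≤ y → y ≤ 4 → lab x = lab p → lab y = lab q →
      |x - y| ≤ 1 := fun x y h1 h2 h3 h4 h5 h6 =>
    (hl.cross p q x y hp hq (hpos x h1 h2) (hpos y h3 h4) h5 h6 hpq).2
  have hp' := hl.range p (Or.inl hp)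
  have hq' := hl.range q (Or.inr hq)
  simp only [abs_le] at hcross
  push_cast at hp' hq'
  rcases htwo 1 with h1 | h1 <;> rcases htwo 4 with h4 | h4
  · have := hcross 1 q (by omega) (by omega) (by omega) (by omega) h1 rfl
    have := hcross 4 q (by omega) (by omega) (by omega) (by omega) h4 rfl
    omega
  · have := hcross 1 4 (by omega) (by omega) (by omega) (by omega) h1 h4
    omega
  · have := hcross 4 1 (by omega) (by omega) (by omega) (by omega) h4 h1
    omega
  · have := hcross p 1 (by omega) (by omega) (by omega) (by omega) rfl h1
    have := hcross p 4 (by omega) (by omega) (by omega) (by omega) rfl h4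
    omega

end CliqueExpr

/-! ### The lower bound and the main theorem -/

theorem le_cliqueWidth_graphZ {k : ℕ} (hk : 1 ≤ k) : (k + 2 : ℕ) ≤ cliqueWidth (graphZ k) := by
  refine le_sInf ?_
  rintro _ ⟨m, rfl, h | ⟨e, he⟩⟩
  · exact (h.false ⟨0, by omega⟩).elim
  · rw [Nat.cast_le]
    by_contra! hm
    rcases hk.lt_or_eq with hk | rfl
    · exact not_defines_graphZ hk (by omega) e he
    · exact not_defines_graphZ_one (by omega) e he

theorem mainTheorem1 (k : ℕ) :
    (∀ S : Set (Fin (k * (k + 1) + 2)), S ≠ Set.univ →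
      linearCliqueWidth ((graphZ k).induce S) ≤ (k + 1 : ℕ)) ∧
    (1 ≤ k →
      (k + 2 : ℕ) ≤ cliqueWidth (graphZ k) ∧
      IsMinimalForbiddenInducedSubgraph (fun G => cliqueWidth G ≤ (k + 1 : ℕ)) (graphZ k) ∧
      IsMinimalForbiddenInducedSubgraph (fun G => linearCliqueWidth G ≤ (k + 1 : ℕ))
        (graphZ k)) := by
  refine ⟨fun S hS => linearCliqueWidth_induce_graphZ_le hS, fun hk => ?_⟩
  have hlow := le_cliqueWidth_graphZ hk
  have hnot : ¬ cliqueWidth (graphZ k) ≤ (k + 1 : ℕ) := fun h => by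
    have := hlow.trans h
    rw [Nat.cast_le] at this
    omega
  exact ⟨hlow,
    ⟨hnot, fun S hS =>
      (cliqueWidth_le_linearCliqueWidth _).trans (linearCliqueWidth_induce_graphZ_le hS)⟩,
    ⟨fun h => hnot ((cliqueWidth_le_linearCliqueWidth _).trans h),
      fun S hS => linearCliqueWidth_induce_graphZ_le hS⟩⟩
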